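/- Let $G$ be a group and let $g_1,\dots,g_n\in G$ be a symmetric generating family (every $g_i^{-1}$ is some $g_j$). Let $\lambda$ be the left regular representation on $\ell^2(G)$, $M=L(G)$ the group von Neumann algebra (the weak operator closure of the linear span of $\lambda(G)$), $J$ the conjugation $(J\xi)(h)=\overline{\xi(h^{-1})}$, $HS$ the Hilbert space of Hilbert–Schmidt operators on $\ell^2(G)$ with its $M,M$-bimodule structure $m\cdot T\cdot m'=mTm'$, and $U_j=\lambda_{g_j}$. Put $$H_0=\{(\Xi_1,\dots,\Xi_n)\in HS^n:\ \exists D\in B(\ell^2(G))\ \ \Xi_j=[D,JU_jJ]\ \text{for all } j\},\qquad \underline{\Delta}(U_1,\dots,U_n)=\dim_{M\bar\otimes M^o}\overline{H_0},$$ where the closure is in the Hilbert–Schmidt norm and $\dim$ is Murray–von Neumann dimension. Let $\beta_0(G),\beta_1(G)$ be the $\ell^2$-Betti numbers of $G$. Then $$\underline{\Delta}(U_1,\dots,U_n)\ \ge\ \beta_1(G)-\beta_0(G)+1 .$$ Moreover, let $A$ be the set of tuples $([m_f,JU_1J],\dots,[m_f,JU_nJ])$, where $m_f$ is multiplication by a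 bounded function $f$ on $G$ such that $h\mapsto f(hg_j)-f(h)$ is in $\ell^2(G)$ for every $j$, and let $MAM$ be the linear span of all $(m a_1 m',\dots,m a_n m')$ with $m,m'\in M$ and $(a_1,\dots,a_n)\in A$. Then $MAM\subseteq H_0$ and $$\dim_{M\bar\otimes M^o}\overline{MAM}=\beta_1(G)-\beta_0(G)+1 .$$ -/

import Mathlib

open scoped ENNReal ComplexConjugate

noncomputable section

namespace GroupL2

/-! ### The Hilbert spaces `ℓ²(A)` and some operators between them -/

/-- The Hilbert space `ℓ²(A)` of square-summable complex functions on a set `A`. -/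
abbrev EllTwo (A : Type*) : Type _ := lp (fun _ : A => ℂ) 2

/-- The bounded operators on `ℓ²(A)`. -/
abbrev Op (A : Type*) : Type _ := EllTwo A →L[ℂ] EllTwo A

open Classical in
/-- The delta function at `a`. -/
def dl {A : Type*} (a : A) : EllTwo A := lp.single 2 a 1

theorem dl_apply {A : Type*} (a b : A) [Decidable (b = a)] :
    dl a b = if b = a then 1 else 0 := by
  classical
  by_cases h : b = a
  · subst h; simp [dl]
  · simp [dl, h]

theorem inner_dl {A : Type*} (a : A) (ξ : EllTwo A) : inner ℂ (dl a) ξ = ξ a := by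
  classical
  simp [dl, lp.inner_single_left]

theorem ellTwo_sum_le {A : Type*} (ξ : EllTwo A) (s : Finset A) :
    ∑ a ∈ s, ‖ξ a‖ ^ 2 ≤ ‖ξ‖ ^ 2 := by
  have := lp.sum_rpow_le_norm_rpow (p := 2) (by norm_num) ξ s
  simpa using this

theorem memEllTwo_of_sum_le {A : Type*} (η : A → ℂ) (C : ℝ)
    (h : ∀ s : Finset A, ∑ a ∈ s, ‖η a‖ ^ 2 ≤ C) : Memℓp η 2 := by
  apply memℓp_gen' (C := C)
  intro s
  simpa using h s

theorem norm_le_of_sum_le {A : Type*} (η : EllTwo A) (C : ℝ) (hC : 0 ≤ C)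
    (h : ∀ s : Finset A, ∑ a ∈ s, ‖η a‖ ^ 2 ≤ C ^ 2) : ‖η‖ ≤ C := by
  apply lp.norm_le_of_forall_sum_le (p := 2) (by norm_num) hC
  intro s
  simpa using h s

/-- A map all of whose fibres have at most `N` elements, for some natural number `N`. -/
def BddFibers {A B : Type*} (f : A → B) : Prop :=
  ∃ N : ℕ, ∀ b, (f ⁻¹' {b}).encard ≤ N

theorem bddFibers_of_injective {A B : Type*} {f : A → B} (hf : Function.Injective f) :
    BddFibers f := by
  refine ⟨1, fun b => ?_⟩
  rw [Nat.cast_one, Set.encard_le_one_iff]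
  intro x y hx hy
  exact hf (hx.trans hy.symm)

theorem pull_sum_le {A B : Type*} {f : A → B} {N : ℕ}
    (hN : ∀ b, (f ⁻¹' {b}).encard ≤ N) (ξ : EllTwo B) (s : Finset A) :
    ∑ a ∈ s, ‖ξ (f a)‖ ^ 2 ≤ N * ‖ξ‖ ^ 2 := by
  classical
  rw [Finset.sum_comp (fun b => ‖ξ b‖ ^ 2) f]
  calc ∑ b ∈ s.image f, (s.filter fun a => f a = b).card • ‖ξ b‖ ^ 2
      ≤ ∑ b ∈ s.image f, (N : ℝ) * ‖ξ b‖ ^ 2 := by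
        refine Finset.sum_le_sum fun b _ => ?_
        rw [nsmul_eq_mul]
        refine mul_le_mul_of_nonneg_right ?_ (by positivity)
        have h1 : (((s.filter fun a => f a = b).card : ℕ) : ℕ∞) ≤ N := by
          rw [← Set.encard_coe_eq_coe_finsetCard]
          refine (Set.encard_le_encard ?_).trans (hN b)
          intro a ha
          simpa using (Finset.mem_filter.1 (Finset.mem_coe.1 ha)).2
        exact_mod_cast h1
    _ = N * ∑ b ∈ s.image f, ‖ξ b‖ ^ 2 := by rw [Finset.mul_sum]
    _ ≤ N * ‖ξ‖ ^ 2 :=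
        mul_le_mul_of_nonneg_left (ellTwo_sum_le ξ _) (Nat.cast_nonneg N)

/-- The bounded operator `ξ ↦ ξ ∘ f` from `ℓ²(B)` to `ℓ²(A)`. -/
def pull {A B : Type*} (f : A → B) (hf : BddFibers f) : EllTwo B →L[ℂ] EllTwo A :=
  LinearMap.mkContinuous
    { toFun := fun ξ => ⟨fun a => ξ (f a),
        memEllTwo_of_sum_le _ _ (pull_sum_le hf.choose_spec ξ)⟩
      map_add' := fun _ _ => rfl
      map_smul' := fun _ _ => rfl }
    (Real.sqrt hf.choose)
    (by
      intro ξ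
      refine norm_le_of_sum_le _ _ (by positivity) fun s => ?_
      rw [mul_pow, Real.sq_sqrt (Nat.cast_nonneg _)]
      exact pull_sum_le hf.choose_spec ξ s)

theorem pull_apply {A B : Type*} (f : A → B) (hf : BddFibers f) (ξ : EllTwo B) (a : A) :
    pull f hf ξ a = ξ (f a) := rfl

/-- The bounded operator from `ℓ²(A)` to `ℓ²(B)` with `δ_a ↦ δ_{f a}`; it is the adjoint of
`pull f`. -/
def push {A B : Type*} (f : A → B) (hf : BddFibers f) : EllTwo A →L[ℂ] EllTwo B :=
  ContinuousLinearMap.adjoint (pull f hf)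

theorem push_dl {A B : Type*} (f : A → B) (hf : BddFibers f) (a : A) :
    push f hf (dl a) = dl (f a) := by
  classical
  apply lp.ext
  funext b
  rw [← inner_dl b, push, ContinuousLinearMap.adjoint_inner_right, ← inner_conj_symm, inner_dl,
    pull_apply, dl_apply, dl_apply]
  by_cases h : f a = b
  · simp [h]
  · simp [h, Ne.symm h]

/-! ### Murray-von Neumann dimension -/

/-- Let `N` be a von Neumann algebra with a faithful normal tracial state, acting on a Hilbert
space `H` that is identified, as an `N`-module, with a direct sum of copies of `L²(N)`, and let
`v i ∈ H` be the vector `1 ∈ L²(N)` in the `i`-th copy. For an `N`-invariant subspace `K` of `H`,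
`vnDim v K` is the Murray-von Neumann dimension of the closure of `K` over `N`, that is the trace
`∑ i, ⟨v i, P (v i)⟩` of the orthogonal projection `P` onto that closure. -/
def vnDim {ι H : Type*} [NormedAddCommGroup H] [InnerProductSpace ℂ H] [CompleteSpace H]
    (v : ι → H) (K : Submodule ℂ H) : ℝ≥0∞ :=
  ∑' i, ENNReal.ofReal (inner ℂ (v i) (K.topologicalClosure.starProjection (v i))).re

/-! ### `ℓ²`-Betti numbers

The contractible free `G`-CW-complex that is used here has one `k`-cell for each `(k+1)`-tuple of
elements of `G` (homogeneous bar construction). The faces of a cell are obtained by dropping one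
vertex, and `G` acts by left translation. -/

section Betti

variable {G : Type*} [Group G]

/-- The `k`-cells of the co-finite subcomplex `X_F` given by a finite subset `F` of `G`: the tuples
`(x_0, …, x_k)` with `x_i⁻¹ x_j ∈ F` for all `i < j`. -/
def Cell (F : Finset G) (k : ℕ) : Type _ :=
  {x : Fin (k + 1) → G // ∀ i j, i < j → (x i)⁻¹ * x j ∈ F}

/-- The `i`-th face of a cell drops the `i`-th vertex. -/
def face (F : Finset G) (k : ℕ) (i : Fin (k + 2)) (x : Cell F (k + 1)) : Cell F k :=
  ⟨fun j => x.1 (i.succAbove j), fun _ _ h => x.2 _ _ (Fin.strictMono_succAbove i h)⟩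

/-- The inclusion of the cells of `X_F` into the cells of `X_{F'}` for `F ⊆ F'`. -/
def incl {F F' : Finset G} (h : F ⊆ F') (k : ℕ) (x : Cell F k) : Cell F' k :=
  ⟨x.1, fun i j hij => h (x.2 i j hij)⟩

theorem bddFibers_incl {F F' : Finset G} (h : F ⊆ F') (k : ℕ) : BddFibers (incl h k) :=
  bddFibers_of_injective fun _ _ hxy => Subtype.ext (congrArg (fun z => z.1) hxy)

theorem bddFibers_face (F : Finset G) (k : ℕ) (i : Fin (k + 2)) : BddFibers (face F k i) := by
  refine ⟨F.card, fun b => ?_⟩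
  have key : ∃ φ : Cell F (k + 1) → G, Set.MapsTo φ (face F k i ⁻¹' {b}) (F : Set G) ∧
      Set.InjOn φ (face F k i ⁻¹' {b}) := by
    have ext' : ∀ x ∈ face F k i ⁻¹' {b}, ∀ y ∈ face F k i ⁻¹' {b}, x.1 i = y.1 i → x = y := by
      intro x hx y hy hxy
      apply Subtype.ext
      funext j
      rcases eq_or_ne j i with rfl | hj
      · exact hxy
      · obtain ⟨l, rfl⟩ := Fin.exists_succAbove_eq hj
        have h2 : face F k i x = face F k i y := hx.trans hy.symm
        exact congrFun (congrArg Subtype.val h2) l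
    have vert : ∀ x ∈ face F k i ⁻¹' {b}, ∀ l, x.1 (i.succAbove l) = b.1 l := by
      intro x hx l
      exact congrFun (congrArg Subtype.val (show face F k i x = b from hx)) l
    rcases eq_or_ne i 0 with rfl | hi
    · refine ⟨fun x => (x.1 0)⁻¹ * x.1 1, fun x _ => x.2 0 1 (by simp), ?_⟩
      intro x hx y hy hxy
      have h0x := vert x hx 0
      have h0y := vert y hy 0
      simp only [Fin.zero_succAbove, Fin.succ_zero_eq_one] at h0x h0y
      simp only [h0x, h0y] at hxy
      exact ext' x hx y hy (inv_injective (mul_right_cancel hxy))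
    · refine ⟨fun x => (x.1 0)⁻¹ * x.1 i, fun x _ => x.2 0 i (Fin.pos_of_ne_zero hi), ?_⟩
      intro x hx y hy hxy
      have h0x := vert x hx 0
      have h0y := vert y hy 0
      rw [Fin.succAbove_ne_zero_zero hi] at h0x h0y
      simp only [h0x, h0y] at hxy
      exact ext' x hx y hy (mul_left_cancel hxy)
  obtain ⟨φ, h1, h2⟩ := key
  rw [← h2.encard_image, ← Set.encard_coe_eq_coe_finsetCard]
  exact Set.encard_le_encard h1.image_subset

/-- The boundary operator `C_{k+1}^{(2)}(X_F) → C_k^{(2)}(X_F)`: the continuous linear operator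
with `δ_x ↦ ∑ i, (-1)^i δ_{d_i x}` for every cell `x`. -/
def bdry (F : Finset G) (k : ℕ) : EllTwo (Cell F (k + 1)) →L[ℂ] EllTwo (Cell F k) :=
  ∑ i : Fin (k + 2), (-1 : ℂ) ^ (i : ℕ) • push (face F k i) (bddFibers_face F k i)

theorem bdry_dl (F : Finset G) (k : ℕ) (x : Cell F (k + 1)) :
    bdry F k (dl x) = ∑ i : Fin (k + 2), (-1 : ℂ) ^ (i : ℕ) • dl (face F k i x) := by
  simp [bdry, push_dl]

/-- The `ℓ²`-cycles: the kernel of the boundary operator on `C_k^{(2)}(X_F)`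
(which is zero for `k = 0`). -/
def cycles (F : Finset G) : (k : ℕ) → Submodule ℂ (EllTwo (Cell F k))
  | 0 => ⊤
  | k + 1 => LinearMap.ker (bdry F k).toLinearMap

/-- The intersection with `C_k^{(2)}(X_F)` of the closure of the image of the boundary operator
`C_{k+1}^{(2)}(X_{F'}) → C_k^{(2)}(X_{F'})`, where `F ⊆ F'`. -/
def boundaries {F F' : Finset G} (h : F ⊆ F') (k : ℕ) : Submodule ℂ (EllTwo (Cell F k)) :=
  (LinearMap.range (bdry F' k).toLinearMap).topologicalClosure.comap
    (push (incl h k) (bddFibers_incl h k)).toLinearMap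

/-- The trace vectors of `C_k^{(2)}(X_F)` as a multiple of `ℓ²(G)`: one cell from each `G`-orbit,
namely the one with initial vertex `1`. -/
def cellVec (F : Finset G) (k : ℕ) (x : {x : Cell F k // x.1 0 = 1}) : EllTwo (Cell F k) :=
  dl x.1

variable (G) in
/-- The `k`-th `ℓ²`-Betti number of `G`, by Cheeger and Gromov's formula
`sup_F inf_{F' ⊇ F} dim_{L(G)} (ker ∂_k on X_F) / (closure (im ∂_{k+1} on X_{F'}) ∩ C_k(X_F))`;
the quotient is realized as an orthogonal complement. -/
def l2Betti (k : ℕ) : ℝ≥0∞ :=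
  ⨆ F : Finset G, ⨅ F' : Finset G, ⨅ h : F ⊆ F',
    vnDim (cellVec F k) (cycles F k ⊓ (boundaries h k)ᗮ)

end Betti

/-! ### The group von Neumann algebra -/

section VN

variable {G : Type*} [Group G]

/-- The left regular representation, `(λ_g ξ)(h) = ξ(g⁻¹ h)`. -/
def leftReg (g : G) : Op G :=
  pull (fun h => g⁻¹ * h) (bddFibers_of_injective (mul_right_injective g⁻¹))

variable (G) in
/-- The group von Neumann algebra `M = L(G)`: the closure in the weak operator topology of the
linear span of the operators `λ_g`. -/
def groupVN : Set (Op G) :=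
  {T | (ContinuousLinearMapWOT.ofCLM T : EllTwo G →WOT[ℂ] EllTwo G) ∈
    closure (ContinuousLinearMapWOT.ofCLM ''
      (Submodule.span ℂ (Set.range (leftReg (G := G))) : Set (Op G)))}

variable (G) in
/-- The Tomita conjugation `J`, `(J ξ)(h) = conj (ξ(h⁻¹))`. -/
def conjJ : EllTwo G →L⋆[ℂ] EllTwo G :=
  ((starₗᵢ ℂ : EllTwo G ≃ₗᵢ⋆[ℂ] EllTwo G).toContinuousLinearEquiv :
    EllTwo G →L⋆[ℂ] EllTwo G).comp (pull (fun h => h⁻¹) (bddFibers_of_injective inv_injective))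

/-- The linear operator `J X J`. -/
def JXJ (X : Op G) : Op G := (conjJ G).comp (X.comp (conjJ G))

theorem mul_sum_le {A : Type*} (f : lp (fun _ : A => ℂ) ∞) (ξ : EllTwo A) (s : Finset A) :
    ∑ a ∈ s, ‖f a * ξ a‖ ^ 2 ≤ (‖f‖ * ‖ξ‖) ^ 2 := by
  calc ∑ a ∈ s, ‖f a * ξ a‖ ^ 2 ≤ ∑ a ∈ s, ‖f‖ ^ 2 * ‖ξ a‖ ^ 2 := by
        refine Finset.sum_le_sum fun a _ => ?_
        rw [norm_mul, mul_pow]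
        gcongr
        exact lp.norm_apply_le_norm (by simp) f a
    _ = ‖f‖ ^ 2 * ∑ a ∈ s, ‖ξ a‖ ^ 2 := by rw [Finset.mul_sum]
    _ ≤ (‖f‖ * ‖ξ‖) ^ 2 := by
        rw [mul_pow]
        gcongr
        exact ellTwo_sum_le ξ s

/-- The operator `m_f` of pointwise multiplication by a bounded function `f`. -/
def mulOp {A : Type*} (f : lp (fun _ : A => ℂ) ∞) : Op A :=
  LinearMap.mkContinuous
    { toFun := fun ξ => ⟨fun a => f a * ξ a, memEllTwo_of_sum_le _ _ (mul_sum_le f ξ)⟩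
      map_add' := fun ξ η => lp.ext (funext fun a => mul_add (f a) (ξ a) (η a))
      map_smul' := fun c ξ => lp.ext (funext fun a => mul_left_comm (f a) c (ξ a)) }
    ‖f‖
    (fun ξ => norm_le_of_sum_le _ _ (by positivity) (mul_sum_le f ξ))

end VN

/-! ### Hilbert-Schmidt operators -/

section HS

/-- The space of Hilbert-Schmidt operators on `ℓ²(A)`: the bounded operators `T` for which
`Tr (T* T) = ∑ y, ‖T δ_y‖²` is finite. -/
def HS (A : Type*) : Submodule ℂ (Op A) where
  carrier := {T | Summable fun y => ‖T (dl y)‖ ^ 2}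
  zero_mem' := by simp
  add_mem' := by
    intro S T hS hT
    refine Summable.of_nonneg_of_le (fun _ => by positivity) (fun y => ?_)
      ((hS.mul_left 2).add (hT.mul_left 2))
    have h1 : ‖(S + T) (dl y)‖ ≤ ‖S (dl y)‖ + ‖T (dl y)‖ := norm_add_le _ _
    have h2 : ‖(S + T) (dl y)‖ ^ 2 ≤ (‖S (dl y)‖ + ‖T (dl y)‖) ^ 2 := by gcongr
    nlinarith [sq_nonneg (‖S (dl y)‖ - ‖T (dl y)‖)]
  smul_mem' := by
    intro c T hT
    refine (hT.mul_left (‖c‖ ^ 2)).congr fun y => ?_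
    rw [smul_apply, norm_smul, mul_pow]

theorem summable_prod_norm_sq {A B : Type*} (w : B → EllTwo A)
    (hw : Summable fun y => ‖w y‖ ^ 2) : Summable fun q : B × A => ‖w q.1 q.2‖ ^ 2 := by
  have hrow : ∀ ξ : EllTwo A, HasSum (fun x => ‖ξ x‖ ^ 2) (‖ξ‖ ^ 2) := by
    intro ξ
    simpa using lp.hasSum_norm (p := 2) (by norm_num) ξ
  refine (summable_prod_of_nonneg (fun _ => by positivity)).2
    ⟨fun y => (hrow (w y)).summable, ?_⟩
  exact hw.congr fun y => ((hrow (w y)).tsum_eq).symm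

theorem memEllTwo_family {ι A : Type*} [Finite ι] (w : ι → A → EllTwo A)
    (hw : ∀ j, Summable fun y => ‖w j y‖ ^ 2) :
    Memℓp (fun p : ι × A × A => w p.1 p.2.2 p.2.1) 2 := by
  have hsum : Summable fun p : ι × A × A => ‖w p.1 p.2.2 p.2.1‖ ^ 2 := by
    refine (summable_prod_of_nonneg (fun _ => by positivity)).2 ⟨fun j => ?_, Summable.of_finite⟩
    exact (Equiv.prodComm A A).summable_iff.2 (summable_prod_norm_sq (w j) (hw j))
  apply memℓp_gen
  simpa using hsum

theorem memEllTwo_matrix {ι A : Type*} [Finite ι] (Ξ : ι → HS A) :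
    Memℓp (fun p : ι × A × A => (Ξ p.1 : Op A) (dl p.2.2) p.2.1) 2 :=
  memEllTwo_family (fun j y => (Ξ j : Op A) (dl y)) fun j => (Ξ j).2

/-- The identification of `HS^ι` with `ℓ²(ι × A × A)` by matrix coefficients,
`Ξ ↦ (⟨δ_x, Ξ_j δ_y⟩)_{(j,x,y)}`. The squared norm of the image of `Ξ` is `∑ j, Tr (Ξ_j* Ξ_j)`. -/
def hsVec {ι A : Type*} [Finite ι] : (ι → HS A) →ₗ[ℂ] EllTwo (ι × A × A) where
  toFun Ξ := ⟨fun p => (Ξ p.1 : Op A) (dl p.2.2) p.2.1, memEllTwo_matrix Ξ⟩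
  map_add' _ _ := rfl
  map_smul' _ _ := rfl

end HS

/-! ### The quantity `Δ̲` -/

section Delta

variable {G : Type*} [Group G] {ι : Type*}

/-- The Murray-von Neumann dimension over `M ⊗ M°` (von Neumann tensor product), for `M = L(G)`, of
the Hilbert-Schmidt closure of an `M,M`-sub-bimodule `K` of `HS^ι`. Under `HS ≅ L²(M ⊗ M°)` the
trace vector `1 ⊗ 1°` is the projection onto `δ_1`, whose only non-zero matrix coefficient is a `1`
at `(1, 1)`. -/
def bimodDim [Finite ι] (K : Submodule ℂ (ι → HS G)) : ℝ≥0∞ :=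
  vnDim (fun j : ι => (dl (j, 1, 1) : EllTwo (ι × G × G))) (K.map hsVec)

/-- `H_0(X) = {Ξ ∈ HS^ι : ∃ D ∈ B(ℓ²(G)), Ξ_j = [D, J X_j J] for all j}`. -/
def Hzero (X : ι → Op G) : Submodule ℂ (ι → HS G) where
  carrier := {Ξ | ∃ D : Op G, ∀ j, (Ξ j : Op G) = D * JXJ (X j) - JXJ (X j) * D}
  zero_mem' := ⟨0, fun j => by simp⟩
  add_mem' := by
    rintro Ξ Ξ' ⟨D, hD⟩ ⟨D', hD'⟩
    refine ⟨D + D', fun j => ?_⟩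
    rw [Pi.add_apply, Submodule.coe_add, hD, hD', add_mul, mul_add]
    abel
  smul_mem' := by
    rintro c Ξ ⟨D, hD⟩
    refine ⟨c • D, fun j => ?_⟩
    rw [Pi.smul_apply, Submodule.coe_smul, hD, smul_mul_assoc, mul_smul_comm, smul_sub]

/-- `Δ̲(X) = dim_{M ⊗ M°}` of the Hilbert-Schmidt closure of `H_0(X)`. -/
def deltaBar [Finite ι] (X : ι → Op G) : ℝ≥0∞ := bimodDim (Hzero X)

/-- The set `A` of the tuples `([m_f, J U_j J])_j`, `U_j = λ_{g_j}`, where `f` is a bounded function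
on `G` with `δ_j f = (h ↦ f(h g_j) - f(h))` in `ℓ²(G)` for all `j`. -/
def multCommutators (g : ι → G) : Set (ι → HS G) :=
  {Ξ | ∃ f : lp (fun _ : G => ℂ) ∞,
    (∀ j, Memℓp (fun h : G => f (h * g j) - f h) 2) ∧
    ∀ j, (Ξ j : Op G) = mulOp f * JXJ (leftReg (g j)) - JXJ (leftReg (g j)) * mulOp f}

/-- The sub-bimodule `M A M` of `HS^ι` generated by `A`, with `M = L(G)`: the linear span of the
tuples `(m a_j m')_j` with `m, m' ∈ M` and `a ∈ A`. -/
def multBimod (g : ι → G) : Submodule ℂ (ι → HS G) :=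
  Submodule.span ℂ {Ξ | ∃ m ∈ groupVN G, ∃ m' ∈ groupVN G, ∃ a ∈ multCommutators g,
    ∀ j, (Ξ j : Op G) = m * (a j : Op G) * m'}

end Delta

end GroupL2

end

/-!
The matrix coefficient at `(x, y)` of `[D, J U_j J]` is `D(x, y g_j⁻¹) - D(x g_j, y)`. The matrix
entries `(j, x, y)` fall into fibres according to the value of `u = x g_j y⁻¹`; each fibre is a copy
of the edge set of the Cayley graph, and on it a tuple of commutators is the coboundary of the
function `x ↦ -D(x, u⁻¹ x)` on the vertices. So `H_0`, and with it `M A M`, lies in the closed space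
`fibrewiseExact` of the families that are exact `1`-cochains on each fibre
(`hsVec_Hzero_le`, `multBimod_le_Hzero`). Conversely `A λ_u` contributes on the fibre over `u` all
square-summable coboundaries of bounded functions, and these are dense in the exact `ℓ²`-cochains by
truncation (`eq_zero_of_orthogonal_bounded`). Hence the closure of `M A M` is all of `fibrewiseExact`, and its
dimension over `M ⊗ M°` is the dimension `z` over `L(G)` of the space of exact `ℓ²`-cochains on the
Cayley graph (`topologicalClosure_multBimod`, `bimodDim_multBimod`).

It remains to see that `β₁ - β₀ + 1 = z`. In the Cheeger-Gromov formula for `β₁` let `F` generate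
`G`. By rank-nullity for the boundary operator, the dimension of the cycles of `X_F` modulo the
boundaries of `X_{F'}` is the dimension of the orthogonal complement of these boundaries, minus `1`,
plus the dimension `β₀` of the constants in `ℓ²(G)`. As `F'` grows, the boundaries exhaust all
loops, so that the intersection of the orthogonal complements is the space of exact cochains on
`X_F` (`exactCells_eq`), and the dimension is continuous along this net. Exact cochains are
determined by their values on a connected subgraph, so the dimension is that of the Cayley graph,
`z`, if `F` is the set of generators, and at most `z` if `F` contains the generators; other `F` do
not matter since the values increase with `F` (`l2Betti_one`).

All comparisons of dimensions rest on one rank-nullity theorem, `card_sub_realDim_ker`. It follows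
from the trace property of matrix coefficients (`trace_comm`) and from the mean ergodic theorem: for
an equivariant contraction `R`, the traces of the `k`-th powers of `1 - R* R` and of `1 - R R*`
differ by a constant independent of `k`, and the averages of these powers converge to the
projections onto the kernels of `R` and of `R*`.
-/

namespace GroupL2

/-! ### Projections and dimensions in a Hilbert space -/

section HilbertDim

variable {ι H : Type*} [NormedAddCommGroup H] [InnerProductSpace ℂ H] [CompleteSpace H]

/-- The orthogonal projection onto the closure of a subspace. -/
noncomputable def closProj (K : Submodule ℂ H) : H →L[ℂ] H := K.topologicalClosure.starProjection

theorem closProj_mem (K : Submodule ℂ H) (x : H) : closProj K x ∈ K.topologicalClosure :=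
  Submodule.starProjection_apply_mem _ _

theorem closProj_mem_of_isClosed {K : Submodule ℂ H} (hK : IsClosed (K : Set H)) (x : H) :
    closProj K x ∈ K := by
  have := closProj_mem K x
  rwa [hK.submodule_topologicalClosure_eq] at this

theorem sub_closProj_mem (K : Submodule ℂ H) (x : H) : x - closProj K x ∈ Kᗮ := by
  rw [← Submodule.orthogonal_closure]
  exact Submodule.sub_starProjection_mem_orthogonal x

theorem closProj_eq_of_mem {K : Submodule ℂ H} {x p : H} (hp : p ∈ K.topologicalClosure)
    (h : x - p ∈ Kᗮ) : closProj K x = p :=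
  (Submodule.eq_starProjection_of_mem_orthogonal hp (by rwa [Submodule.orthogonal_closure]))

theorem closProj_of_mem {K : Submodule ℂ H} {x : H} (hx : x ∈ K) : closProj K x = x :=
  closProj_eq_of_mem (K.le_topologicalClosure hx) (by simp)

theorem closProj_of_mem_orthogonal {K : Submodule ℂ H} {x : H} (hx : x ∈ Kᗮ) :
    closProj K x = 0 :=
  closProj_eq_of_mem (zero_mem _) (by simpa using hx)

theorem closProj_topologicalClosure (K : Submodule ℂ H) :
    closProj K.topologicalClosure = closProj K := by
  ext x
  refine closProj_eq_of_mem (Submodule.le_topologicalClosure _ (closProj_mem K x)) ?_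
  rw [Submodule.orthogonal_closure]
  exact sub_closProj_mem K x

theorem closProj_orthogonal (K : Submodule ℂ H) (x : H) : closProj Kᗮ x = x - closProj K x := by
  refine closProj_eq_of_mem (Submodule.le_topologicalClosure _ (sub_closProj_mem K x)) ?_
  rw [sub_sub_cancel, Submodule.orthogonal_orthogonal_eq_closure]
  exact closProj_mem K x

theorem closProj_inf_orthogonal {Z B : Submodule ℂ H} (hZ : IsClosed (Z : Set H))
    (hB : IsClosed (B : Set H)) (h : B ≤ Z) (x : H) :
    closProj (Z ⊓ Bᗮ) x = closProj Z x - closProj B x := by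
  refine closProj_eq_of_mem (Submodule.le_topologicalClosure _ ⟨?_, ?_⟩) ?_
  · exact sub_mem (closProj_mem_of_isClosed hZ x) (h (closProj_mem_of_isClosed hB x))
  · have h1 : closProj Z x - closProj B x = (x - closProj B x) - (x - closProj Z x) := by abel
    rw [SetLike.mem_coe, h1]
    exact sub_mem (sub_closProj_mem B x) (Submodule.orthogonal_le h (sub_closProj_mem Z x))
  · have h1 : x - (closProj Z x - closProj B x) = (x - closProj Z x) + closProj B x := by abel
    rw [h1]
    refine add_mem (Submodule.orthogonal_le inf_le_left (sub_closProj_mem Z x)) ?_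
    exact Submodule.orthogonal_le inf_le_right
      (Submodule.le_orthogonal_orthogonal _ (closProj_mem_of_isClosed hB x))

theorem inner_closProj (K : Submodule ℂ H) (x y : H) :
    inner ℂ (closProj K x) y = inner ℂ x (closProj K y) :=
  Submodule.inner_starProjection_left_eq_right _ _ _

theorem closProj_idem (K : Submodule ℂ H) (x : H) : closProj K (closProj K x) = closProj K x := by
  rw [← closProj_topologicalClosure K]
  exact closProj_of_mem (by rw [closProj_topologicalClosure]; exact closProj_mem K x)

theorem re_inner_closProj (K : Submodule ℂ H) (x : H) :
    (inner ℂ x (closProj K x)).re = ‖closProj K x‖ ^ 2 := by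
  rw [← closProj_idem, ← inner_closProj, closProj_idem]
  exact inner_self_eq_norm_sq (𝕜 := ℂ) _

theorem norm_closProj_mono {K K' : Submodule ℂ H} (h : K ≤ K') (x : H) :
    ‖closProj K x‖ ≤ ‖closProj K' x‖ := by
  have h1 : closProj K x = closProj K (closProj K' x) := by
    rw [← sub_eq_zero, ← map_sub]
    exact closProj_of_mem_orthogonal (Submodule.orthogonal_le h (sub_closProj_mem K' x))
  rw [h1]
  exact Submodule.norm_starProjection_apply_le _ _

theorem vnDim_mono (v : ι → H) {K K' : Submodule ℂ H} (h : K ≤ K') : vnDim v K ≤ vnDim v K' := by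
  refine ENNReal.tsum_le_tsum fun i => ENNReal.ofReal_le_ofReal ?_
  have h1 := re_inner_closProj K (v i)
  have h2 := re_inner_closProj K' (v i)
  rw [closProj] at h1 h2
  rw [h1, h2]
  have := norm_closProj_mono h (v i)
  simp only [closProj] at this
  gcongr

/-- For a finite family of trace vectors, the Murray-von Neumann dimension as a real number. -/
noncomputable def realDim [Fintype ι] (v : ι → H) (K : Submodule ℂ H) : ℝ :=
  ∑ i, (inner ℂ (v i) (closProj K (v i))).re

theorem vnDim_eq_ofReal [Fintype ι] (v : ι → H) (K : Submodule ℂ H) :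
    vnDim v K = ENNReal.ofReal (realDim v K) := by
  rw [vnDim, tsum_fintype, realDim, ENNReal.ofReal_sum_of_nonneg]
  · rfl
  · intro i _
    rw [re_inner_closProj]
    positivity

variable [Fintype ι] (v : ι → H)

theorem realDim_nonneg (K : Submodule ℂ H) : 0 ≤ realDim v K :=
  Finset.sum_nonneg fun i _ => by rw [re_inner_closProj]; positivity

theorem realDim_mono {K K' : Submodule ℂ H} (h : K ≤ K') : realDim v K ≤ realDim v K' :=
  Finset.sum_le_sum fun i _ => by
    rw [re_inner_closProj, re_inner_closProj]
    have := norm_closProj_mono h (v i)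
    gcongr

theorem realDim_orthogonal (hv : ∀ i, ‖v i‖ = 1) (K : Submodule ℂ H) :
    realDim v Kᗮ = Fintype.card ι - realDim v K := by
  simp [realDim, closProj_orthogonal, hv, Finset.sum_sub_distrib]

theorem realDim_inf_orthogonal {Z B : Submodule ℂ H} (hZ : IsClosed (Z : Set H))
    (hB : IsClosed (B : Set H)) (h : B ≤ Z) :
    realDim v (Z ⊓ Bᗮ) = realDim v Z - realDim v B := by
  simp [realDim, closProj_inf_orthogonal hZ hB h, Finset.sum_sub_distrib]

theorem realDim_topologicalClosure (K : Submodule ℂ H) :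
    realDim v K.topologicalClosure = realDim v K := by
  simp [realDim, closProj_topologicalClosure]

/-- The dimension is continuous along increasing nets of subspaces. -/
theorem tendsto_realDim_iSup {α : Type*} [Preorder α] {B : α → Submodule ℂ H} (hB : Monotone B)
    (hc : ∀ a, IsClosed (B a : Set H)) :
    Filter.Tendsto (fun a => realDim v (B a)) Filter.atTop (nhds (realDim v (⨆ a, B a))) := by
  refine tendsto_finsetSum _ fun i _ => ?_
  have hproj : ∀ a, (B a).HasOrthogonalProjection := fun a => by
    have : CompleteSpace (B a) := (hc a).completeSpace_coe
    infer_instance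
  have key := Submodule.starProjection_tendsto_closure_iSup B hB (v i)
  have h1 : ∀ a, (B a).starProjection (v i) = closProj (B a) (v i) := fun a =>
    (closProj_eq_of_mem (Submodule.le_topologicalClosure _ (Submodule.starProjection_apply_mem _ _))
      (Submodule.sub_starProjection_mem_orthogonal _)).symm
  simp only [h1] at key
  exact (Complex.continuous_re.tendsto _).comp (tendsto_const_nhds.inner key)

/-- The mean ergodic theorem: the averages of the powers of a contraction `U` converge strongly
to the projection onto the kernel of `1 - U`. -/
theorem tendsto_average_pow (U : H →L[ℂ] H) (hU : ‖U‖ ≤ 1) (x : H) :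
    Filter.Tendsto (fun N : ℕ => (N : ℂ)⁻¹ • ∑ k ∈ Finset.range N, (U ^ k) x) Filter.atTop
      (nhds (closProj (LinearMap.ker (1 - U : H →L[ℂ] H).toLinearMap) x)) := by
  have key := U.tendsto_birkhoffAverage_orthogonalProjection hU x
  have h1 : ∀ N : ℕ, birkhoffAverage ℂ U id N x
      = (N : ℂ)⁻¹ • ∑ k ∈ Finset.range N, (U ^ k) x := by
    intro N
    simp [birkhoffAverage, birkhoffSum]
  simp only [h1] at key
  convert key using 2
  have hker : LinearMap.ker (1 - U : H →L[ℂ] H).toLinearMap = U.eqLocus (1 : H →L[ℂ] H) := by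
    ext y
    rw [LinearMap.mem_ker, LinearMap.mem_eqLocus]
    exact sub_eq_zero.trans eq_comm
  rw [hker]
  refine closProj_eq_of_mem (Submodule.le_topologicalClosure _ (Subtype.mem _)) ?_
  exact Submodule.sub_starProjection_mem_orthogonal x

end HilbertDim

/-! ### Operators on `ℓ²` of a set -/

section EllTwo

variable {A B C : Type*}

theorem norm_dl (a : A) : ‖(dl a : EllTwo A)‖ = 1 := by
  classical
  simp [dl, lp.norm_single]

theorem adjoint_apply_eq (T : EllTwo A →L[ℂ] EllTwo B) (η : EllTwo B) (a : A) :
    ContinuousLinearMap.adjoint T η a = inner ℂ (T (dl a)) η := by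
  rw [← inner_dl, ContinuousLinearMap.adjoint_inner_right]

theorem clm_ext_dl {S T : EllTwo A →L[ℂ] EllTwo B} (h : ∀ a, S (dl a) = T (dl a)) : S = T := by
  apply ContinuousLinearMap.adjoint.injective
  ext η a
  rw [adjoint_apply_eq, adjoint_apply_eq, h]

theorem inner_push_left (f : A → B) (hf : BddFibers f) (ξ : EllTwo A) (η : EllTwo B) :
    inner ℂ (push f hf ξ) η = inner ℂ ξ (pull f hf η) :=
  ContinuousLinearMap.adjoint_inner_left _ _ _

theorem inner_push_right (f : A → B) (hf : BddFibers f) (ξ : EllTwo A) (η : EllTwo B) :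
    inner ℂ η (push f hf ξ) = inner ℂ (pull f hf η) ξ :=
  ContinuousLinearMap.adjoint_inner_right _ _ _

theorem push_comp_push {f : A → B} (hf : BddFibers f) {k : B → C} (hk : BddFibers k)
    (hkf : BddFibers (k ∘ f)) (ξ : EllTwo A) : push k hk (push f hf ξ) = push (k ∘ f) hkf ξ := by
  have : (push k hk).comp (push f hf) = push (k ∘ f) hkf := clm_ext_dl fun a => by simp [push_dl]
  exact congrArg (fun T => T ξ) this

theorem pull_push {f : A → B} (hf : Function.Injective f) (hb : BddFibers f) (ξ : EllTwo A) :
    pull f hb (push f hb ξ) = ξ := by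
  have : (pull f hb).comp (push f hb) = ContinuousLinearMap.id ℂ _ := clm_ext_dl fun a => by
    classical
    ext b
    simp [push_dl, pull_apply, dl_apply, hf.eq_iff]
  exact congrArg (fun T => T ξ) this

theorem push_apply {f : A → B} (hf : Function.Injective f) (hb : BddFibers f) (ξ : EllTwo A)
    (a : A) : push f hb ξ (f a) = ξ a := by
  rw [← pull_apply f hb, pull_push hf]

theorem push_apply_of_notMem {f : A → B} (hb : BddFibers f) (ξ : EllTwo A) {b : B}
    (h : b ∉ Set.range f) : push f hb ξ b = 0 := by
  classical
  rw [← inner_dl, inner_push_right]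
  have : pull f hb (dl b) = 0 := by
    ext a
    rw [pull_apply, dl_apply, if_neg fun e => h ⟨a, e⟩]
    rfl
  rw [this, inner_zero_left]

theorem push_injective {f : A → B} (hf : Function.Injective f) (hb : BddFibers f) :
    Function.Injective (push f hb) :=
  Function.LeftInverse.injective (g := pull f hb) (pull_push hf hb)

end EllTwo

/-! ### Equivariant operators and the comparison of dimensions -/

section Equivariant

variable {G : Type*} [Group G] {A B C : Type*} [MulAction G A] [MulAction G B] [MulAction G C]

/-- The translation operator `δ_a ↦ δ_{g a}` on `ℓ²(A)`, for a `G`-set `A`. -/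
noncomputable def shift (g : G) : Op A :=
  pull (fun a => g⁻¹ • a) (bddFibers_of_injective (MulAction.injective g⁻¹))

theorem shift_apply (g : G) (ξ : EllTwo A) (a : A) : shift g ξ a = ξ (g⁻¹ • a) := rfl

theorem shift_dl (g : G) (a : A) : shift g (dl a) = dl (g • a) := by
  classical
  ext b
  simp [shift_apply, dl_apply, inv_smul_eq_iff]

theorem adjoint_shift (g : G) : ContinuousLinearMap.adjoint (shift g : Op A) = shift g⁻¹ := by
  ext η a
  rw [adjoint_apply_eq, shift_dl, inner_dl, shift_apply, inv_inv]

variable (G) in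
/-- A bounded operator that commutes with the translations. -/
def Equivariant (T : EllTwo A →L[ℂ] EllTwo B) : Prop :=
  ∀ (g : G) (ξ : EllTwo A), T (shift g ξ) = shift g (T ξ)

variable (G) in
/-- A subspace of `ℓ²(A)` that is invariant under translations. -/
def Invariant (K : Submodule ℂ (EllTwo A)) : Prop :=
  ∀ (g : G), ∀ ξ ∈ K, shift g ξ ∈ K

variable (G) in
/-- `A` is a free `G`-set, and `r` lists one point of each orbit. -/
def IsFreeBasis {ι : Type*} (r : ι → A) : Prop :=
  Function.Bijective fun p : G × ι => p.1 • r p.2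

theorem Equivariant.comp {S : EllTwo B →L[ℂ] EllTwo C} {T : EllTwo A →L[ℂ] EllTwo B}
    (hS : Equivariant G S) (hT : Equivariant G T) : Equivariant G (S.comp T) := fun g ξ => by
  simp [hT g ξ, hS g]

theorem Equivariant.smul {T : EllTwo A →L[ℂ] EllTwo B} (hT : Equivariant G T) (c : ℂ) :
    Equivariant G (c • T) := fun g ξ => by
  simp [hT g ξ]

theorem Equivariant.sub {S T : EllTwo A →L[ℂ] EllTwo B} (hS : Equivariant G S)
    (hT : Equivariant G T) : Equivariant G (S - T) := fun g ξ => by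
  simp [hT g ξ, hS g ξ]

theorem Equivariant.sum {α : Type*} {s : Finset α} {T : α → EllTwo A →L[ℂ] EllTwo B}
    (hT : ∀ i ∈ s, Equivariant G (T i)) : Equivariant G (∑ i ∈ s, T i) := fun g ξ => by
  simp only [sum_apply, map_sum]
  exact Finset.sum_congr rfl fun i hi => hT i hi g ξ

theorem Equivariant.adjoint {T : EllTwo A →L[ℂ] EllTwo B} (hT : Equivariant G T) :
    Equivariant G (ContinuousLinearMap.adjoint T) := fun g ξ => by
  refine ext_inner_left ℂ fun η => ?_
  have h : (shift g : Op A) = ContinuousLinearMap.adjoint (shift g⁻¹) := by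
    rw [adjoint_shift, inv_inv]
  have h' : (shift g : Op B) = ContinuousLinearMap.adjoint (shift g⁻¹) := by
    rw [adjoint_shift, inv_inv]
  rw [h, h', ContinuousLinearMap.adjoint_inner_right, ContinuousLinearMap.adjoint_inner_right,
    ContinuousLinearMap.adjoint_inner_right, ContinuousLinearMap.adjoint_inner_right, hT]

theorem equivariant_one : Equivariant G (1 : Op A) := fun _ _ => rfl

theorem Equivariant.pow {T : Op A} (hT : Equivariant G T) (k : ℕ) : Equivariant G (T ^ k) := by
  induction k with
  | zero => exact equivariant_one
  | succ k ih =>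
    rw [pow_succ]
    exact ih.comp hT

theorem equivariant_pull {f : A → B} (hb : BddFibers f) (hf : ∀ (g : G) a, f (g • a) = g • f a) :
    Equivariant G (pull f hb) := fun g ξ => by
  ext a
  simp only [pull_apply, shift_apply, hf]

theorem equivariant_push {f : A → B} (hb : BddFibers f) (hf : ∀ (g : G) a, f (g • a) = g • f a) :
    Equivariant G (push f hb) :=
  (equivariant_pull hb hf).adjoint

theorem Invariant.orthogonal {K : Submodule ℂ (EllTwo A)} (hK : Invariant G K) :
    Invariant G Kᗮ := fun g ξ hξ η hη => by
  rw [← inv_inv g, ← adjoint_shift, ContinuousLinearMap.adjoint_inner_right]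
  exact hξ _ (hK _ _ hη)

theorem Invariant.inf {K K' : Submodule ℂ (EllTwo A)} (hK : Invariant G K)
    (hK' : Invariant G K') : Invariant G (K ⊓ K') :=
  fun g ξ hξ => ⟨hK g ξ hξ.1, hK' g ξ hξ.2⟩

theorem Invariant.topologicalClosure {K : Submodule ℂ (EllTwo A)} (hK : Invariant G K) :
    Invariant G K.topologicalClosure :=
  fun g _ hξ => map_mem_closure (shift g).continuous hξ fun ξ h => hK g ξ h

theorem Invariant.comap {K : Submodule ℂ (EllTwo B)} (hK : Invariant G K)
    {T : EllTwo A →L[ℂ] EllTwo B} (hT : Equivariant G T) : Invariant G (K.comap T.toLinearMap) :=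
  fun g ξ hξ => by
    change T (shift g ξ) ∈ K
    rw [hT]
    exact hK g _ hξ

theorem Equivariant.invariant_ker {T : EllTwo A →L[ℂ] EllTwo B} (hT : Equivariant G T) :
    Invariant G (LinearMap.ker T.toLinearMap) := fun g ξ hξ => by
  change T (shift g ξ) = 0
  rw [hT, show T ξ = 0 from hξ, map_zero]

theorem Equivariant.invariant_range {T : EllTwo A →L[ℂ] EllTwo B} (hT : Equivariant G T) :
    Invariant G (LinearMap.range T.toLinearMap) := by
  rintro g _ ⟨ξ, rfl⟩
  exact ⟨shift g ξ, hT g ξ⟩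

theorem Invariant.equivariant_closProj {K : Submodule ℂ (EllTwo A)} (hK : Invariant G K) :
    Equivariant G (closProj K) := fun g ξ => by
  refine closProj_eq_of_mem (hK.topologicalClosure g _ (closProj_mem K ξ)) ?_
  rw [← map_sub]
  exact hK.orthogonal g _ (sub_closProj_mem K ξ)

variable {ι κ : Type*} [Fintype ι] [Fintype κ] {r : ι → A} {s : κ → B}

/-- Expansion of one side of the trace identity `trace_comm` in matrix coefficients. -/
theorem hasSum_trace {D : Type*} (hs : IsFreeBasis G s) {X : EllTwo D →L[ℂ] EllTwo B}
    {Y : EllTwo B →L[ℂ] EllTwo D} (r : ι → D) :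
    HasSum (fun g : G => ∑ j, ∑ i, Y (dl (g • s j)) (r i) * X (dl (r i)) (g • s j))
      (∑ i, inner ℂ (dl (r i)) (Y (X (dl (r i))))) := by
  have h1 : ∀ i, HasSum (fun p : G × κ => Y (dl (p.1 • s p.2)) (r i) * X (dl (r i)) (p.1 • s p.2))
      (inner ℂ (dl (r i)) (Y (X (dl (r i))))) := by
    intro i
    have h2 := lp.hasSum_inner (𝕜 := ℂ) (ContinuousLinearMap.adjoint Y (dl (r i))) (X (dl (r i)))
    rw [ContinuousLinearMap.adjoint_inner_left] at h2
    refine ((Equiv.ofBijective _ hs).hasSum_iff.2 h2).congr_fun ?_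
    intro p
    have h3 : ContinuousLinearMap.adjoint Y (dl (r i)) (p.1 • s p.2) =
        starRingEnd ℂ (Y (dl (p.1 • s p.2)) (r i)) := by
      rw [adjoint_apply_eq, ← inner_conj_symm, inner_dl]
    change _ = X (dl (r i)) (p.1 • s p.2) *
      starRingEnd ℂ (ContinuousLinearMap.adjoint Y (dl (r i)) (p.1 • s p.2))
    rw [h3, Complex.conj_conj, mul_comm]
  exact (hasSum_sum fun i _ => h1 i).prod_fiberwise fun g => hasSum_fintype _

/-- The trace property of the group von Neumann algebra, for equivariant operators between free
`G`-spaces with finitely many orbits. -/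
theorem trace_comm (hr : IsFreeBasis G r) (hs : IsFreeBasis G s) {X : EllTwo A →L[ℂ] EllTwo B}
    {Y : EllTwo B →L[ℂ] EllTwo A} (hX : Equivariant G X) (hY : Equivariant G Y) :
    ∑ i, inner ℂ (dl (r i)) (Y (X (dl (r i)))) = ∑ j, inner ℂ (dl (s j)) (X (Y (dl (s j)))) := by
  have h1 := (Equiv.inv G).hasSum_iff.2 (hasSum_trace hs (X := X) (Y := Y) r)
  have h2 := hasSum_trace hr (X := Y) (Y := X) s
  -- By equivariance, the two expansions differ by the substitution of `g⁻¹` for `g`.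
  refine h1.unique ?_
  convert h2 using 2 with g
  rw [Function.comp_apply, Finset.sum_comm]
  refine Finset.sum_congr rfl fun i _ => Finset.sum_congr rfl fun j _ => ?_
  rw [Equiv.inv_apply, ← shift_dl, ← shift_dl, hY, hX, shift_apply, shift_apply, inv_inv, mul_comm]

/-- `1 - R* R` is a contraction, since `‖ξ - R* R ξ‖² = ‖ξ‖² - 2 ‖R ξ‖² + ‖R* R ξ‖²`. -/
theorem norm_one_sub_adjoint_comp_le {H H' : Type*} [NormedAddCommGroup H] [InnerProductSpace ℂ H]
    [CompleteSpace H] [NormedAddCommGroup H'] [InnerProductSpace ℂ H'] [CompleteSpace H']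
    (R : H →L[ℂ] H') (hR : ‖R‖ ≤ 1) : ‖1 - (ContinuousLinearMap.adjoint R).comp R‖ ≤ 1 := by
  refine ContinuousLinearMap.opNorm_le_bound _ zero_le_one fun ξ => ?_
  have h1 : ‖ContinuousLinearMap.adjoint R (R ξ)‖ ≤ ‖R ξ‖ := by
    refine (ContinuousLinearMap.le_opNorm _ _).trans (mul_le_of_le_one_left (norm_nonneg _) ?_)
    rwa [LinearIsometryEquiv.norm_map]
  have h2 : RCLike.re (inner ℂ ξ (ContinuousLinearMap.adjoint R (R ξ))) = ‖R ξ‖ ^ 2 := by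
    rw [ContinuousLinearMap.adjoint_inner_right]
    exact inner_self_eq_norm_sq _
  have h3 := norm_sub_sq (𝕜 := ℂ) ξ (ContinuousLinearMap.adjoint R (R ξ))
  rw [h2] at h3
  have h4 : ‖ContinuousLinearMap.adjoint R (R ξ)‖ ^ 2 ≤ ‖R ξ‖ ^ 2 := by gcongr
  change ‖ξ - ContinuousLinearMap.adjoint R (R ξ)‖ ≤ 1 * ‖ξ‖
  rw [one_mul]
  exact le_of_sq_le_sq (by nlinarith [sq_nonneg ‖R ξ‖]) (norm_nonneg _)

theorem ker_adjoint_comp {H H' : Type*} [NormedAddCommGroup H] [InnerProductSpace ℂ H]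
    [CompleteSpace H] [NormedAddCommGroup H'] [InnerProductSpace ℂ H'] [CompleteSpace H']
    (R : H →L[ℂ] H') : LinearMap.ker ((ContinuousLinearMap.adjoint R).comp R).toLinearMap =
      LinearMap.ker R.toLinearMap := by
  ext ξ
  refine ⟨fun h => ?_, fun h => ?_⟩
  · have h1 : ContinuousLinearMap.adjoint R (R ξ) = 0 := h
    have h2 := ContinuousLinearMap.adjoint_inner_right R ξ (R ξ)
    rw [h1, inner_zero_right] at h2
    exact inner_self_eq_zero.1 h2.symm
  · have h1 : R ξ = 0 := h
    change ContinuousLinearMap.adjoint R (R ξ) = 0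
    rw [h1, map_zero]

/-- The averages of the traces of the powers of the contraction `1 - R* R` converge to the
dimension of the kernel of `R`. -/
theorem tendsto_average_trace {R : EllTwo A →L[ℂ] EllTwo B} (hR1 : ‖R‖ ≤ 1) (r : ι → A) :
    Filter.Tendsto (fun N : ℕ => ((N : ℂ)⁻¹ * ∑ k ∈ Finset.range N, ∑ i, inner ℂ (dl (r i))
        (((1 - (ContinuousLinearMap.adjoint R).comp R) ^ k : Op A) (dl (r i)))).re)
      Filter.atTop (nhds (realDim (fun i => dl (r i)) (LinearMap.ker R.toLinearMap))) := by
  have h1 : Filter.Tendsto (fun N : ℕ => ∑ i, (inner ℂ (dl (r i)) ((N : ℂ)⁻¹ •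
        ∑ k ∈ Finset.range N, ((1 - (ContinuousLinearMap.adjoint R).comp R) ^ k : Op A)
          (dl (r i)))).re) Filter.atTop
      (nhds (realDim (fun i => dl (r i)) (LinearMap.ker R.toLinearMap))) := by
    refine tendsto_finsetSum _ fun i _ => ?_
    have h2 := tendsto_average_pow _ (norm_one_sub_adjoint_comp_le R hR1) (dl (r i))
    rw [sub_sub_cancel, ker_adjoint_comp] at h2
    exact (Complex.continuous_re.tendsto _).comp (tendsto_const_nhds.inner h2)
  refine h1.congr fun N => ?_
  rw [← Complex.re_sum, Finset.sum_comm, Finset.mul_sum]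
  congr 1
  refine Finset.sum_congr rfl fun i _ => ?_
  rw [inner_smul_right, inner_sum]

/-- The case of a contraction in `card_sub_realDim_ker`. With `U = 1 - R* R` and `W = 1 - R R*`, the
operators `1 - U ^ k` and `1 - W ^ k` have the same trace, and the averages of the powers of `U` and
of `W` converge to the projections onto the kernels of `R` and of `R*`. -/
theorem card_sub_realDim_ker_of_norm_le_one (hr : IsFreeBasis G r) (hs : IsFreeBasis G s)
    {R : EllTwo A →L[ℂ] EllTwo B} (hR : Equivariant G R) (hR1 : ‖R‖ ≤ 1) :
    Fintype.card ι - realDim (fun i => dl (r i)) (LinearMap.ker R.toLinearMap) =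
      Fintype.card κ - realDim (fun j => dl (s j))
        (LinearMap.ker (ContinuousLinearMap.adjoint R).toLinearMap) := by
  set Ra := ContinuousLinearMap.adjoint R with hRa
  set U : Op A := 1 - Ra.comp R with hU
  set W : Op B := 1 - R.comp Ra with hW
  have hUe : Equivariant G U := equivariant_one.sub (hR.adjoint.comp hR)
  have hRU : ∀ (k : ℕ) (ξ : EllTwo A), R ((U ^ k) ξ) = (W ^ k) (R ξ) := by
    intro k
    induction k with
    | zero => exact fun _ => rfl
    | succ k ih =>
      intro ξ
      rw [pow_succ, pow_succ]
      change R ((U ^ k) (U ξ)) = (W ^ k) (W (R ξ))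
      rw [ih]
      simp [hU, hW]
  -- `1 - U ^ k = Y R` and `1 - W ^ k = R Y` for `Y = (1 + U + ⋯ + U ^ (k - 1)) R*`.
  have htr : ∀ k : ℕ, (Fintype.card ι : ℂ) - ∑ i, inner ℂ (dl (r i)) ((U ^ k) (dl (r i))) =
      Fintype.card κ - ∑ j, inner ℂ (dl (s j)) ((W ^ k) (dl (s j))) := by
    intro k
    have hY : Equivariant G ((∑ l ∈ Finset.range k, U ^ l).comp Ra) :=
      (Equivariant.sum fun l _ => hUe.pow l).comp hR.adjoint
    have h1 := trace_comm hr hs hR hY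
    have h2 : ∀ ξ, (∑ l ∈ Finset.range k, U ^ l).comp Ra (R ξ) = ξ - (U ^ k) ξ := by
      intro ξ
      have := geom_sum_mul_neg U k
      rw [hU, sub_sub_cancel] at this
      exact congrArg (fun T : Op A => T ξ) this
    have h3 : ∀ ξ, R ((∑ l ∈ Finset.range k, U ^ l).comp Ra ξ) = ξ - (W ^ k) ξ := by
      intro ξ
      have := geom_sum_mul_neg W k
      rw [hW, sub_sub_cancel] at this
      refine Eq.trans ?_ (congrArg (fun T : Op B => T ξ) this)
      change R ((∑ l ∈ Finset.range k, U ^ l) (Ra ξ)) =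
        (∑ l ∈ Finset.range k, W ^ l) (R (Ra ξ))
      rw [sum_apply, sum_apply, map_sum]
      exact Finset.sum_congr rfl fun l _ => hRU l _
    simp only [h2, h3, inner_sub_right, Finset.sum_sub_distrib] at h1
    simpa [norm_dl] using h1
  have hlim := (tendsto_average_trace hR1 r).sub
    (tendsto_average_trace (R := Ra) (by rwa [hRa, LinearIsometryEquiv.norm_map]) s)
  have hlim' : Filter.Tendsto (fun _ : ℕ => (Fintype.card ι : ℝ) - Fintype.card κ) Filter.atTop
      (nhds (realDim (fun i => dl (r i)) (LinearMap.ker R.toLinearMap) -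
        realDim (fun j => dl (s j)) (LinearMap.ker Ra.toLinearMap))) := by
    refine hlim.congr' ?_
    filter_upwards [Filter.eventually_ne_atTop 0] with N hN
    rw [hRa, ContinuousLinearMap.adjoint_adjoint, ← hRa, ← hU, ← hW, ← Complex.sub_re, ← mul_sub,
      ← Finset.sum_sub_distrib]
    have h1 : ∀ k, (∑ i, inner ℂ (dl (r i)) ((U ^ k) (dl (r i)))) -
        ∑ j, inner ℂ (dl (s j)) ((W ^ k) (dl (s j))) = (Fintype.card ι : ℂ) - Fintype.card κ := by
      intro k
      linear_combination -htr k
    simp only [h1, Finset.sum_const, Finset.card_range, nsmul_eq_mul]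
    rw [inv_mul_cancel_left₀ (by exact_mod_cast hN)]
    simp
  have := tendsto_nhds_unique hlim' tendsto_const_nhds
  linarith

/-- The rank-nullity theorem for Murray-von Neumann dimensions: the closures of the images of an
equivariant operator and of its adjoint have the same dimension. -/
theorem card_sub_realDim_ker (hr : IsFreeBasis G r) (hs : IsFreeBasis G s)
    {R : EllTwo A →L[ℂ] EllTwo B} (hR : Equivariant G R) :
    Fintype.card ι - realDim (fun i => dl (r i)) (LinearMap.ker R.toLinearMap) =
      Fintype.card κ - realDim (fun j => dl (s j))
        (LinearMap.ker (ContinuousLinearMap.adjoint R).toLinearMap) := by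
  have hc : ((‖R‖ + 1 : ℝ) : ℂ)⁻¹ ≠ 0 := inv_ne_zero (by exact_mod_cast (by positivity))
  have key := card_sub_realDim_ker_of_norm_le_one hr hs
    (hR.smul ((‖R‖ + 1 : ℝ) : ℂ)⁻¹) (by
      rw [norm_smul, norm_inv, Complex.norm_real, Real.norm_of_nonneg (by positivity),
        inv_mul_le_one₀ (by positivity)]
      linarith)
  rw [map_smulₛₗ] at key
  have h1 : LinearMap.ker (((‖R‖ + 1 : ℝ) : ℂ)⁻¹ • R).toLinearMap = LinearMap.ker R.toLinearMap :=
    LinearMap.ker_smul _ _ hc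
  have h2 : LinearMap.ker (starRingEnd ℂ ((‖R‖ + 1 : ℝ) : ℂ)⁻¹ •
      ContinuousLinearMap.adjoint R).toLinearMap =
        LinearMap.ker (ContinuousLinearMap.adjoint R).toLinearMap :=
    LinearMap.ker_smul _ _ ((map_ne_zero _).2 hc)
  rwa [h1, h2] at key

/-- An invariant closed subspace that an equivariant operator maps injectively into another one
has at most its dimension. -/
theorem realDim_le_of_injOn (hr : IsFreeBasis G r) (hs : IsFreeBasis G s)
    {K : Submodule ℂ (EllTwo A)} {K' : Submodule ℂ (EllTwo B)} (hK : Invariant G K)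
    (hK' : Invariant G K') (hKc : IsClosed (K : Set (EllTwo A)))
    {T : EllTwo A →L[ℂ] EllTwo B} (hT : Equivariant G T) (hmap : ∀ ξ ∈ K, T ξ ∈ K')
    (hinj : ∀ ξ ∈ K, T ξ = 0 → ξ = 0) :
    realDim (fun i => dl (r i)) K ≤ realDim (fun j => dl (s j)) K' := by
  have hR := (hK'.equivariant_closProj.comp hT).comp hK.equivariant_closProj
  have key := card_sub_realDim_ker hr hs hR
  have hker : LinearMap.ker (((closProj K').comp T).comp (closProj K)).toLinearMap = Kᗮ := by
    ext ξ
    have hPξ := closProj_mem_of_isClosed hKc ξ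
    have h1 : (((closProj K').comp T).comp (closProj K)) ξ = T (closProj K ξ) :=
      closProj_of_mem (hmap _ hPξ)
    rw [LinearMap.mem_ker]
    change (((closProj K').comp T).comp (closProj K)) ξ = 0 ↔ _
    rw [h1]
    refine ⟨fun h => ?_, fun h => by rw [closProj_of_mem_orthogonal h, map_zero]⟩
    have := sub_closProj_mem K ξ
    rwa [hinj _ hPξ h, sub_zero] at this
  -- The dimension of `K` is that of the closure of the image of `R`, which lies in `K'`.
  have hker' : K'ᗮ ≤ LinearMap.ker (ContinuousLinearMap.adjoint
      (((closProj K').comp T).comp (closProj K))).toLinearMap := by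
    intro η hη
    change ContinuousLinearMap.adjoint (((closProj K').comp T).comp (closProj K)) η = 0
    refine ext_inner_left ℂ fun ξ => ?_
    rw [ContinuousLinearMap.adjoint_inner_right, inner_zero_right]
    change inner ℂ (closProj K' _) η = 0
    rw [inner_closProj, closProj_of_mem_orthogonal hη, inner_zero_right]
  have h1 := realDim_mono (fun j => dl (s j)) hker'
  rw [hker, realDim_orthogonal _ fun i => norm_dl _] at key
  rw [realDim_orthogonal _ fun i => norm_dl _] at h1
  linarith

end Equivariant

/-! ### Exact `1`-cochains of a graph on a group -/

section Exact

variable {G : Type*} [Group G]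

theorem continuous_apply_ellTwo {A : Type*} (a : A) : Continuous fun ξ : EllTwo A => ξ a := by
  simp only [← inner_dl a]
  fun_prop

theorem eq_of_mul_right_invariant {α : Type*} {S : Set G} (hS : Subgroup.closure S = ⊤) {f : G → α}
    (h : ∀ x, ∀ s ∈ S, f (x * s) = f x) (x y : G) : f x = f y := by
  have key : ∀ z ∈ Subgroup.closure S, ∀ x, f (x * z) = f x := by
    intro z hz
    induction hz using Subgroup.closure_induction with
    | mem s hs => exact fun x => h x s hs
    | one => simp
    | mul a b _ _ ha hb => exact fun x => by rw [← mul_assoc, hb, ha]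
    | inv a _ ha => exact fun x => by simpa using (ha (x * a⁻¹)).symm
  have := key (x⁻¹ * y) (by rw [hS]; trivial) x
  rwa [mul_inv_cancel_left, eq_comm] at this

/-- The square-summable `1`-cochains on a graph with vertex set `G` and edge set `E` that are the
coboundary of a function on `G`, which need not be square-summable. -/
def exactCochains {E : Type*} (src tgt : E → G) : Submodule ℂ (EllTwo E) where
  carrier := {c | ∃ f : G → ℂ, ∀ e, c e = f (tgt e) - f (src e)}
  zero_mem' := ⟨0, fun e => by simp⟩
  add_mem' := by
    rintro c c' ⟨f, hf⟩ ⟨f', hf'⟩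
    refine ⟨f + f', fun e => ?_⟩
    rw [lp.coeFn_add, Pi.add_apply, hf, hf', Pi.add_apply, Pi.add_apply]
    ring
  smul_mem' := by
    rintro z c ⟨f, hf⟩
    refine ⟨z • f, fun e => ?_⟩
    rw [lp.coeFn_smul, Pi.smul_apply, hf, Pi.smul_apply, Pi.smul_apply, smul_sub]

/-- The graph contains the Cayley graph of `G` for a generating set (in particular, it is
connected). -/
def ContainsCayley {E : Type*} (src tgt : E → G) : Prop :=
  ∃ S : Set G, Subgroup.closure S = ⊤ ∧ ∀ x, ∀ s ∈ S, ∃ e, src e = x ∧ tgt e = x * s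

variable {E E' : Type*} {src tgt : E → G} {src' tgt' : E' → G}

theorem ContainsCayley.eq_of_forall_edge (h : ContainsCayley src tgt) {α : Type*} {f : G → α}
    (hf : ∀ e, f (tgt e) = f (src e)) (x y : G) : f x = f y := by
  obtain ⟨S, hS, hE⟩ := h
  refine eq_of_mul_right_invariant hS (fun x s hs => ?_) x y
  obtain ⟨e, rfl, he⟩ := hE x s hs
  rw [← he, hf]

/-- On a connected graph, a primitive of an exact cochain is the sum of the cochain along a path, so
it depends continuously on the cochain. -/
theorem ContainsCayley.exists_primitive (h : ContainsCayley src tgt) (x y : G) :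
    ∃ φ : EllTwo E →L[ℂ] ℂ, ∀ (c : EllTwo E) (f : G → ℂ),
      (∀ e, c e = f (tgt e) - f (src e)) → φ c = f y - f x := by
  obtain ⟨S, hS, hE⟩ := h
  have key : ∀ z ∈ Subgroup.closure S, ∀ x, ∃ φ : EllTwo E →L[ℂ] ℂ, ∀ (c : EllTwo E) (f : G → ℂ),
      (∀ e, c e = f (tgt e) - f (src e)) → φ c = f (x * z) - f x := by
    intro z hz
    induction hz using Subgroup.closure_induction with
    | mem s hs =>
      intro x
      obtain ⟨e, he1, he2⟩ := hE x s hs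
      refine ⟨innerSL ℂ (dl e), fun c f hf => ?_⟩
      rw [innerSL_apply_apply, inner_dl, hf, he1, he2]
    | one => exact fun x => ⟨0, fun c f _ => by simp⟩
    | mul a b _ _ ha hb =>
      intro x
      obtain ⟨φ, hφ⟩ := ha x
      obtain ⟨ψ, hψ⟩ := hb (x * a)
      refine ⟨φ + ψ, fun c f hf => ?_⟩
      rw [add_apply, hφ c f hf, hψ c f hf, mul_assoc]
      ring
    | inv a _ ha =>
      intro x
      obtain ⟨φ, hφ⟩ := ha (x * a⁻¹)
      refine ⟨-φ, fun c f hf => ?_⟩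
      rw [neg_apply, hφ c f hf, inv_mul_cancel_right]
      ring
  obtain ⟨φ, hφ⟩ := key (x⁻¹ * y) (by rw [hS]; trivial) x
  exact ⟨φ, by simpa using hφ⟩

theorem ContainsCayley.isClosed_exactCochains (h : ContainsCayley src tgt) :
    IsClosed (exactCochains src tgt : Set (EllTwo E)) := by
  choose φ hφ using h.exists_primitive 1
  have : (exactCochains src tgt : Set (EllTwo E)) =
      ⋂ e, {c | c e = φ (tgt e) c - φ (src e) c} := by
    ext c
    simp only [SetLike.mem_coe, Set.mem_iInter, Set.mem_ofPred_eq]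
    refine ⟨fun ⟨f, hf⟩ e => ?_, fun hc => ⟨fun x => φ x c, hc⟩⟩
    rw [hφ _ c f hf, hφ _ c f hf, hf]
    ring
  rw [this]
  exact isClosed_iInter fun e => isClosed_eq (continuous_apply_ellTwo e) (by fun_prop)

theorem pull_mem_exactCochains {V : Type*} {src tgt : E → V} {src' tgt' : E' → V} (k : E' → E)
    (hk : BddFibers k) (hsrc : ∀ e, src (k e) = src' e) (htgt : ∀ e, tgt (k e) = tgt' e)
    {c : EllTwo E} (hc : c ∈ exactCochains src tgt) :
    pull k hk c ∈ exactCochains src' tgt' := by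
  obtain ⟨f, hf⟩ := hc
  exact ⟨f, fun e => by rw [pull_apply, hf, hsrc, htgt]⟩

theorem invariant_exactCochains [MulAction G E] (hsrc : ∀ (g : G) e, src (g • e) = g * src e)
    (htgt : ∀ (g : G) e, tgt (g • e) = g * tgt e) : Invariant G (exactCochains src tgt) := by
  rintro g c ⟨f, hf⟩
  exact ⟨fun x => f (g⁻¹ * x), fun e => by rw [shift_apply, hf, hsrc, htgt]⟩

/-- Restriction to a connected subgraph is injective on exact cochains. -/
theorem realDim_exactCochains_le [MulAction G E] [MulAction G E'] {ι κ : Type*} [Fintype ι]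
    [Fintype κ] {r : ι → E} {s : κ → E'} (hr : IsFreeBasis G r) (hs : IsFreeBasis G s)
    (hsrc : ∀ (g : G) e, src (g • e) = g * src e) (htgt : ∀ (g : G) e, tgt (g • e) = g * tgt e)
    (hsrc' : ∀ (g : G) e, src' (g • e) = g * src' e)
    (htgt' : ∀ (g : G) e, tgt' (g • e) = g * tgt' e)
    (h : ContainsCayley src tgt) (h' : ContainsCayley src' tgt') (k : E' → E) (hk : BddFibers k)
    (hkG : ∀ (g : G) e, k (g • e) = g • k e) (hksrc : ∀ e, src (k e) = src' e)
    (hktgt : ∀ e, tgt (k e) = tgt' e) :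
    realDim (fun i => dl (r i)) (exactCochains src tgt) ≤
      realDim (fun j => dl (s j)) (exactCochains src' tgt') := by
  refine realDim_le_of_injOn hr hs (invariant_exactCochains hsrc htgt)
    (invariant_exactCochains hsrc' htgt') h.isClosed_exactCochains (equivariant_pull hk hkG)
    (fun c hc => pull_mem_exactCochains k hk hksrc hktgt hc) ?_
  rintro c ⟨f, hf⟩ h0
  ext e
  rw [hf, h'.eq_of_forall_edge (f := f) (fun e' => ?_) (tgt e) (src e), sub_self]
  · rfl
  · rw [← hksrc, ← hktgt, ← sub_eq_zero, ← hf, ← pull_apply k hk, h0]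
    rfl

theorem memEllTwo_comp {A B : Type*} {w : B → ℂ} (hw : Memℓp w 2) {k : A → B} (hk : BddFibers k) :
    Memℓp (fun a => w (k a)) 2 :=
  (pull k hk ⟨w, hw⟩).2

theorem memEllTwo_prod {κ A : Type*} [Finite κ] {w : κ × A → ℂ}
    (hw : ∀ j, Memℓp (fun x => w (j, x)) 2) : Memℓp w 2 := by
  refine memℓp_gen ((summable_prod_of_nonneg fun _ => by positivity).2
    ⟨fun j => (hw j).summable (by norm_num), Summable.of_finite⟩)

/-- If right translation by the elements of a generating set changes `f` by a square-summable
function only, then so does right translation by any element. -/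
theorem memEllTwo_mul_right_sub {S : Set G} (hS : Subgroup.closure S = ⊤) {f : G → ℂ}
    (hf : ∀ s ∈ S, Memℓp (fun x => f (x * s) - f x) 2) (y : G) :
    Memℓp (fun x => f (x * y) - f x) 2 := by
  have hy : y ∈ Subgroup.closure S := by rw [hS]; trivial
  have hb : ∀ z : G, BddFibers fun x : G => x * z := fun z =>
    bddFibers_of_injective (mul_left_injective z)
  induction hy using Subgroup.closure_induction with
  | mem s hs => exact hf s hs
  | one =>
    simp only [mul_one, sub_self]
    exact zero_memℓp
  | mul a b _ _ ha hb' =>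
    convert (memEllTwo_comp hb' (hb a)).add ha using 2 with x
    simp [mul_assoc]
  | inv a _ ha =>
    convert (memEllTwo_comp ha (hb a⁻¹)).neg using 2 with x
    simp

end Exact

/-! ### The chain complexes of the subcomplexes `X_F` -/

section Cells

variable {G : Type*} [Group G]

instance (F : Finset G) (k : ℕ) : MulAction G (Cell F k) where
  smul g x := ⟨fun i => g * x.1 i, fun i j h => by simpa [mul_assoc] using x.2 i j h⟩
  one_smul x := Subtype.ext (funext fun i => one_mul _)
  mul_smul g h x := Subtype.ext (funext fun i => mul_assoc _ _ _)

theorem cell_ext {F : Finset G} {k : ℕ} {x y : Cell F k} (h : ∀ i, x.1 i = y.1 i) : x = y :=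
  Subtype.ext (funext h)

theorem isFreeBasis_cell (F : Finset G) (k : ℕ) :
    IsFreeBasis G (fun x : {x : Cell F k // x.1 0 = 1} => x.1) := by
  refine ⟨?_, fun x => ⟨⟨x.1 0, (x.1 0)⁻¹ • x, inv_mul_cancel _⟩, smul_inv_smul _ _⟩⟩
  rintro ⟨g, x, hx⟩ ⟨g', x', hx'⟩ h
  change g • x = g' • x' at h
  have h0 : g * x.1 0 = g' * x'.1 0 := congrArg (fun z : Cell F k => z.1 0) h
  rw [hx, hx', mul_one, mul_one] at h0
  subst h0
  have := MulAction.injective g h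
  subst this
  rfl

instance (F : Finset G) (k : ℕ) : Finite {x : Cell F k // x.1 0 = 1} := by
  classical
  refine Finite.of_injective
    (β := Fin (k + 1) → ((insert 1 F : Finset G) : Set G)) (fun x i => ⟨x.1.1 i, ?_⟩) ?_
  · rcases Fin.eq_zero_or_eq_succ i with rfl | ⟨j, rfl⟩
    · simp [x.2]
    · have := x.1.2 0 j.succ (Fin.succ_pos j)
      rw [x.2, inv_one, one_mul] at this
      simp [this]
  · intro x y h
    exact Subtype.ext (cell_ext fun i => congrArg Subtype.val (congrFun h i))

noncomputable instance (F : Finset G) (k : ℕ) : Fintype {x : Cell F k // x.1 0 = 1} :=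
  Fintype.ofFinite _

theorem incl_injective {F F' : Finset G} (h : F ⊆ F') (k : ℕ) :
    Function.Injective (incl h k) := fun _ _ hxy =>
  Subtype.ext (congrArg (fun z : Cell F' k => z.1) hxy)

theorem equivariant_bdry (F : Finset G) (k : ℕ) : Equivariant G (bdry F k) :=
  Equivariant.sum fun i _ => (equivariant_push (bddFibers_face F k i) fun _ _ => rfl).smul _

theorem equivariant_push_incl {F F' : Finset G} (h : F ⊆ F') (k : ℕ) :
    Equivariant G (push (incl h k) (bddFibers_incl h k)) :=
  equivariant_push _ fun _ _ => rfl

theorem push_incl_bdry {F F' : Finset G} (h : F ⊆ F') (k : ℕ) (ξ : EllTwo (Cell F (k + 1))) :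
    push (incl h k) (bddFibers_incl h k) (bdry F k ξ) =
      bdry F' k (push (incl h (k + 1)) (bddFibers_incl h (k + 1)) ξ) := by
  have : (push (incl h k) (bddFibers_incl h k)).comp (bdry F k) =
      (bdry F' k).comp (push (incl h (k + 1)) (bddFibers_incl h (k + 1))) :=
    clm_ext_dl fun x => by
      simp only [ContinuousLinearMap.comp_apply, bdry_dl, push_dl, map_sum, map_smul]
      rfl
  exact congrArg (fun T => T ξ) this

theorem push_incl_push_incl {F F' F'' : Finset G} (h : F ⊆ F') (h' : F' ⊆ F'') (k : ℕ)
    (ξ : EllTwo (Cell F k)) :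
    push (incl h' k) (bddFibers_incl h' k) (push (incl h k) (bddFibers_incl h k) ξ) =
      push (incl (h.trans h') k) (bddFibers_incl (h.trans h') k) ξ :=
  push_comp_push (bddFibers_incl h k) (bddFibers_incl h' k) (bddFibers_incl (h.trans h') k) ξ

theorem mem_range_bdry_orthogonal {F : Finset G} {k : ℕ} {ξ : EllTwo (Cell F k)} :
    ξ ∈ (LinearMap.range (bdry F k).toLinearMap)ᗮ ↔
      ∀ x, ∑ i : Fin (k + 2), (-1 : ℂ) ^ (i : ℕ) * ξ (face F k i x) = 0 := by
  have h1 : ∀ x, ContinuousLinearMap.adjoint (bdry F k) ξ x =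
      ∑ i : Fin (k + 2), (-1 : ℂ) ^ (i : ℕ) * ξ (face F k i x) := by
    intro x
    rw [adjoint_apply_eq, bdry_dl, sum_inner]
    refine Finset.sum_congr rfl fun i _ => ?_
    rw [inner_smul_left, inner_dl]
    simp
  rw [ContinuousLinearMap.orthogonal_range]
  simp only [← h1]
  refine ⟨fun h x => ?_, fun h => lp.ext (funext h)⟩
  rw [show ContinuousLinearMap.adjoint (bdry F k) ξ = 0 from h]
  rfl

theorem isClosed_boundaries {F F' : Finset G} (h : F ⊆ F') (k : ℕ) :
    IsClosed (boundaries h k : Set (EllTwo (Cell F k))) :=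
  (Submodule.isClosed_topologicalClosure _).preimage
    (push (incl h k) (bddFibers_incl h k)).continuous

theorem invariant_boundaries {F F' : Finset G} (h : F ⊆ F') (k : ℕ) :
    Invariant G (boundaries h k) :=
  (equivariant_bdry F' k).invariant_range.topologicalClosure.comap (equivariant_push_incl h k)

theorem push_incl_mem_closure_range {F F' : Finset G} (h : F ⊆ F') (k : ℕ)
    {η : EllTwo (Cell F k)} (hη : η ∈ (LinearMap.range (bdry F k).toLinearMap).topologicalClosure) :
    push (incl h k) (bddFibers_incl h k) η ∈
      (LinearMap.range (bdry F' k).toLinearMap).topologicalClosure := by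
  refine map_mem_closure (push (incl h k) (bddFibers_incl h k)).continuous hη ?_
  rintro _ ⟨ζ, rfl⟩
  exact ⟨_, (push_incl_bdry h k ζ).symm⟩

theorem boundaries_mono {F F' F'' : Finset G} (h : F ⊆ F') (h' : F' ⊆ F'') (k : ℕ) :
    boundaries h k ≤ boundaries (h.trans h') k := by
  intro ξ hξ
  change push (incl (h.trans h') k) (bddFibers_incl (h.trans h') k) ξ ∈
    (LinearMap.range (bdry F'' k).toLinearMap).topologicalClosure
  rw [← push_incl_push_incl h h']
  exact push_incl_mem_closure_range h' k hξ

theorem pull_incl_mem_boundaries_orthogonal {F F' : Finset G} (h : F ⊆ F') (k : ℕ)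
    {η : EllTwo (Cell F' k)} (hη : η ∈ (LinearMap.range (bdry F' k).toLinearMap)ᗮ) :
    pull (incl h k) (bddFibers_incl h k) η ∈ (boundaries h k)ᗮ := by
  intro ξ hξ
  rw [← inner_push_left]
  rw [← Submodule.orthogonal_closure] at hη
  exact hη _ hξ

end Cells

/-! ### Low-dimensional cells -/

section LowCells

variable {G : Type*} [Group G]

/-- The `0`-cell at `a`. -/
def vtx (F : Finset G) (a : G) : Cell F 0 :=
  ⟨fun _ => a, fun i j h => absurd (Fin.lt_def.1 h) (by omega)⟩

/-- The `1`-cell from `a` to `b`. -/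
def edge (F : Finset G) (a b : G) (h : a⁻¹ * b ∈ F) : Cell F 1 :=
  ⟨![a, b], fun i j hij => by fin_cases i <;> fin_cases j <;> simp_all⟩

/-- The `2`-cell with vertices `a`, `b` and `c`. -/
def tri (F : Finset G) (a b c : G) (hab : a⁻¹ * b ∈ F) (hac : a⁻¹ * c ∈ F) (hbc : b⁻¹ * c ∈ F) :
    Cell F 2 :=
  ⟨![a, b, c], fun i j hij => by fin_cases i <;> fin_cases j <;> simp_all⟩

theorem eq_vtx {F : Finset G} (x : Cell F 0) : x = vtx F (x.1 0) :=
  cell_ext fun i => congrArg x.1 (Fin.fin_one_eq_zero i)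

theorem face_zero_zero {F : Finset G} (x : Cell F 1) : face F 0 0 x = vtx F (x.1 1) :=
  eq_vtx _

theorem face_zero_one {F : Finset G} (x : Cell F 1) : face F 0 1 x = vtx F (x.1 0) :=
  eq_vtx _

theorem bdry_zero_dl {F : Finset G} (x : Cell F 1) :
    bdry F 0 (dl x) = dl (vtx F (x.1 1)) - dl (vtx F (x.1 0)) := by
  simp [bdry_dl, Fin.sum_univ_succ, face_zero_zero, face_zero_one, sub_eq_add_neg]

theorem bdry_one_dl {F : Finset G} (x : Cell F 2) :
    bdry F 1 (dl x) = dl (face F 1 0 x) - dl (face F 1 1 x) + dl (face F 1 2 x) := by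
  simp [bdry_dl, Fin.sum_univ_succ, sub_eq_add_neg, add_assoc]

theorem eq_edge {F : Finset G} (x : Cell F 1) {a b : G} (ha : x.1 0 = a) (hb : x.1 1 = b) :
    x = edge F a b (by rw [← ha, ← hb]; exact x.2 0 1 (by simp)) :=
  cell_ext fun i => by fin_cases i <;> simp [edge, ha, hb]

theorem bdry_one_tri {F : Finset G} (a b c : G) (hab : a⁻¹ * b ∈ F) (hac : a⁻¹ * c ∈ F)
    (hbc : b⁻¹ * c ∈ F) : bdry F 1 (dl (tri F a b c hab hac hbc)) =
      dl (edge F b c hbc) - dl (edge F a c hac) + dl (edge F a b hab) := by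
  have h0 : face F 1 0 (tri F a b c hab hac hbc) = edge F b c hbc := eq_edge _ rfl rfl
  have h1 : face F 1 1 (tri F a b c hab hac hbc) = edge F a c hac := eq_edge _ rfl rfl
  have h2 : face F 1 2 (tri F a b c hab hac hbc) = edge F a b hab := eq_edge _ rfl rfl
  rw [bdry_one_dl, h0, h1, h2]

theorem bdry_bdry {F : Finset G} (ξ : EllTwo (Cell F 2)) : bdry F 0 (bdry F 1 ξ) = 0 := by
  have : (bdry F 0).comp (bdry F 1) = 0 := clm_ext_dl fun x => by
    rw [ContinuousLinearMap.comp_apply, bdry_one_dl, map_add, map_sub, bdry_zero_dl, bdry_zero_dl,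
      bdry_zero_dl]
    change (dl (vtx F (x.1 2)) - dl (vtx F (x.1 1))) - (dl (vtx F (x.1 2)) - dl (vtx F (x.1 0)))
      + (dl (vtx F (x.1 1)) - dl (vtx F (x.1 0))) = 0
    abel
  exact congrArg (fun T => T ξ) this

theorem boundaries_le_cycles {F F' : Finset G} (h : F ⊆ F') :
    boundaries h 1 ≤ cycles F 1 := by
  intro ξ hξ
  refine push_injective (incl_injective h 0) (bddFibers_incl h 0) ?_
  change push _ _ (bdry F 0 ξ) = push _ _ 0
  rw [push_incl_bdry, map_zero]
  have h1 : (LinearMap.range (bdry F' 1).toLinearMap).topologicalClosure ≤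
      LinearMap.ker (bdry F' 0).toLinearMap := by
    refine Submodule.topologicalClosure_minimal _ ?_ (bdry F' 0).isClosed_ker
    rintro _ ⟨ζ, rfl⟩
    exact bdry_bdry ζ
  exact h1 hξ

theorem isClosed_cycles (F : Finset G) : IsClosed (cycles F 1 : Set (EllTwo (Cell F 1))) :=
  (bdry F 0).isClosed_ker

theorem invariant_cycles (F : Finset G) : Invariant G (cycles F 1) :=
  (equivariant_bdry F 0).invariant_ker

theorem containsCayley_cell {F : Finset G} (hF : Subgroup.closure (F : Set G) = ⊤) :
    ContainsCayley (fun x : Cell F 1 => x.1 0) (fun x => x.1 1) :=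
  ⟨F, hF, fun x s hs => ⟨edge F x (x * s) (by simpa using hs), rfl, rfl⟩⟩

end LowCells

/-! ### Degree zero -/

section DegreeZero

variable {G : Type*} [Group G]

/-- The constant functions in `ℓ²` of the `0`-cells. -/
def constCochains (F : Finset G) : Submodule ℂ (EllTwo (Cell F 0)) where
  carrier := {ξ | ∀ x y, ξ x = ξ y}
  zero_mem' := fun _ _ => rfl
  add_mem' := fun hξ hη x y => by
    rw [lp.coeFn_add, Pi.add_apply, Pi.add_apply, hξ x y, hη x y]
  smul_mem' := fun c ξ hξ x y => by
    rw [lp.coeFn_smul, Pi.smul_apply, Pi.smul_apply, hξ x y]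

theorem isClosed_constCochains (F : Finset G) :
    IsClosed (constCochains F : Set (EllTwo (Cell F 0))) := by
  have : (constCochains F : Set (EllTwo (Cell F 0))) = ⋂ x, ⋂ y, {ξ | ξ x = ξ y} := by
    ext ξ
    simp only [Set.mem_iInter]
    rfl
  rw [this]
  exact isClosed_iInter fun x => isClosed_iInter fun y =>
    isClosed_eq (continuous_apply_ellTwo x) (continuous_apply_ellTwo y)

theorem invariant_constCochains (F : Finset G) : Invariant G (constCochains F) :=
  fun _ _ hξ _ _ => hξ _ _

theorem constCochains_le (F : Finset G) :
    constCochains F ≤ (LinearMap.range (bdry F 0).toLinearMap)ᗮ := by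
  intro ξ hξ
  rw [mem_range_bdry_orthogonal]
  intro x
  simp only [Fin.sum_univ_succ]
  rw [hξ (face F 0 0 x) (face F 0 1 x)]
  simp

theorem eq_const_of_generates {F F' : Finset G} (hF' : Subgroup.closure (F' : Set G) = ⊤)
    {ξ : EllTwo (Cell F 0)} (h : ∀ x, ∀ s ∈ F', ξ (vtx F (x * s)) = ξ (vtx F x)) :
    ξ ∈ constCochains F := by
  intro x y
  rw [eq_vtx x, eq_vtx y]
  exact eq_of_mul_right_invariant hF' (f := fun a => ξ (vtx F a)) h _ _

theorem range_bdry_zero_orthogonal {F : Finset G} (hF : Subgroup.closure (F : Set G) = ⊤) :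
    (LinearMap.range (bdry F 0).toLinearMap)ᗮ = constCochains F := by
  refine le_antisymm (fun ξ hξ => eq_const_of_generates hF fun x s hs => ?_) (constCochains_le F)
  have := hξ _ ⟨dl (edge F x (x * s) (by simpa using hs)), rfl⟩
  change inner ℂ (bdry F 0 _) ξ = 0 at this
  rw [bdry_zero_dl, inner_sub_left, inner_dl, inner_dl, sub_eq_zero] at this
  exact this

theorem constCochains_le_boundaries_orthogonal {F F' : Finset G} (h : F ⊆ F') :
    constCochains F ≤ (boundaries h 0)ᗮ := by
  intro ξ hξ
  have hb : BddFibers fun x : Cell F' 0 => vtx F (x.1 0) := bddFibers_of_injective fun x y hxy => by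
    rw [eq_vtx x, eq_vtx y]
    exact congrArg (vtx F') (congrArg (fun z : Cell F 0 => z.1 0) hxy)
  have h1 := pull_incl_mem_boundaries_orthogonal h 0
    (constCochains_le F' (show pull _ hb ξ ∈ constCochains F' from fun x y => hξ _ _))
  convert h1
  ext x
  exact hξ _ _

theorem boundaries_zero_orthogonal {F F' : Finset G} (h : F ⊆ F')
    (hF' : Subgroup.closure (F' : Set G) = ⊤) : (boundaries h 0)ᗮ = constCochains F := by
  refine le_antisymm (fun ξ hξ => eq_const_of_generates hF' fun x s hs => ?_)
    (constCochains_le_boundaries_orthogonal h)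
  have h1 : dl (vtx F (x * s)) - dl (vtx F x) ∈ boundaries h 0 := by
    refine Submodule.le_topologicalClosure _ ⟨dl (edge F' x (x * s) (by simpa using hs)), ?_⟩
    change bdry F' 0 _ = push _ _ _
    rw [bdry_zero_dl, map_sub, push_dl, push_dl]
    rfl
  have := hξ _ h1
  rw [inner_sub_left, inner_dl, inner_dl, sub_eq_zero] at this
  exact this

theorem realDim_constCochains_le (F F' : Finset G) :
    realDim (cellVec F 0) (constCochains F) ≤ realDim (cellVec F' 0) (constCochains F') := by
  have hb : BddFibers fun x : Cell F' 0 => vtx F (x.1 0) := bddFibers_of_injective fun x y hxy => by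
    rw [eq_vtx x, eq_vtx y]
    exact congrArg (vtx F') (congrArg (fun z : Cell F 0 => z.1 0) hxy)
  refine realDim_le_of_injOn (isFreeBasis_cell F 0) (isFreeBasis_cell F' 0)
    (invariant_constCochains F) (invariant_constCochains F') (isClosed_constCochains F)
    (T := pull _ hb) (equivariant_pull hb fun _ _ => rfl) (fun ξ hξ x y => hξ _ _) ?_
  intro ξ _ h0
  ext x
  rw [eq_vtx x]
  exact congrArg (fun η : EllTwo (Cell F' 0) => η (vtx F' (x.1 0))) h0

/-- `β₀(G)` is the dimension of the space of constant functions in `ℓ²(G)`. -/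
theorem l2Betti_zero {S : Finset G} (hS : Subgroup.closure (S : Set G) = ⊤) (F₀ : Finset G) :
    l2Betti G 0 = ENNReal.ofReal (realDim (cellVec F₀ 0) (constCochains F₀)) := by
  classical
  have h1 : ∀ F : Finset G, (⨅ F' : Finset G, ⨅ h : F ⊆ F',
      vnDim (cellVec F 0) (cycles F 0 ⊓ (boundaries h 0)ᗮ)) =
        ENNReal.ofReal (realDim (cellVec F₀ 0) (constCochains F₀)) := by
    intro F
    rw [(realDim_constCochains_le F₀ F).antisymm (realDim_constCochains_le F F₀),
      ← vnDim_eq_ofReal]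
    simp only [cycles, top_inf_eq]
    refine le_antisymm ?_ (le_iInf fun F' => le_iInf fun h =>
      vnDim_mono _ (constCochains_le_boundaries_orthogonal h))
    refine (iInf₂_le (F ∪ S) Finset.subset_union_left).trans_eq ?_
    rw [boundaries_zero_orthogonal]
    rw [eq_top_iff, ← hS]
    exact Subgroup.closure_mono (by simp)
  simp only [l2Betti, h1, ciSup_const]

end DegreeZero

/-! ### Degree one -/

section DegreeOne

variable {G : Type*} [Group G]

theorem realDim_cycles {F : Finset G} (hF : Subgroup.closure (F : Set G) = ⊤) :
    realDim (cellVec F 1) (cycles F 1) = Fintype.card {x : Cell F 1 // x.1 0 = 1} - 1 +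
      realDim (cellVec F 0) (constCochains F) := by
  have h1 := card_sub_realDim_ker (isFreeBasis_cell F 1) (isFreeBasis_cell F 0)
    (equivariant_bdry F 0)
  rw [← ContinuousLinearMap.orthogonal_range, range_bdry_zero_orthogonal hF] at h1
  have h2 : Fintype.card {x : Cell F 0 // x.1 0 = 1} = 1 := by
    rw [Fintype.card_eq_one_iff]
    refine ⟨⟨vtx F 1, rfl⟩, fun x => Subtype.ext ?_⟩
    rw [eq_vtx x.1, x.2]
  rw [h2, Nat.cast_one] at h1
  change _ - realDim (cellVec F 1) (cycles F 1) = 1 - realDim (cellVec F 0) _ at h1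
  linarith

/-- The exact `1`-cochains on `X_F`. -/
abbrev exactCells (F : Finset G) : Submodule ℂ (EllTwo (Cell F 1)) :=
  exactCochains (fun x : Cell F 1 => x.1 0) (fun x => x.1 1)

/-- For generating `F`, an exact cochain on `X_F` extends to an exact cochain on each `X_{F'}`, so
it is orthogonal to all boundaries. -/
theorem exactCells_le_boundaries_orthogonal {F F' : Finset G} (h : F ⊆ F')
    (hF : Subgroup.closure (F : Set G) = ⊤) : exactCells F ≤ (boundaries h 1)ᗮ := by
  rintro c ⟨f, hf⟩
  have hs : ∀ s ∈ F, Memℓp (fun x => f (x * s) - f x) 2 := by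
    intro s hs
    have hb : BddFibers fun x : G => edge F x (x * s) (by simpa using hs) :=
      bddFibers_of_injective fun x y hxy => congrArg (fun z : Cell F 1 => z.1 0) hxy
    convert memEllTwo_comp (lp.memℓp c) hb using 2 with x
    exact (hf (edge F x (x * s) (by simpa using hs))).symm
  have hall := memEllTwo_mul_right_sub hF hs
  have hb : BddFibers fun x : Cell F' 1 => ((⟨(x.1 0)⁻¹ * x.1 1, x.2 0 1 (by simp)⟩ : F'), x.1 0) :=
    bddFibers_of_injective fun x y hxy => by
      have h0 : x.1 0 = y.1 0 := congrArg Prod.snd hxy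
      have h1 : (x.1 0)⁻¹ * x.1 1 = (y.1 0)⁻¹ * y.1 1 :=
        congrArg Subtype.val (congrArg Prod.fst hxy)
      rw [h0, mul_right_inj] at h1
      exact cell_ext fun i => by fin_cases i <;> assumption
  have hc' : Memℓp (fun x : Cell F' 1 => f (x.1 1) - f (x.1 0)) 2 := by
    have := memEllTwo_comp (memEllTwo_prod (κ := F') (w := fun p => f (p.2 * p.1) - f p.2)
      fun j => hall j) hb
    simpa using this
  have h1 := pull_incl_mem_boundaries_orthogonal h 1 (η := ⟨_, hc'⟩) <| by
    rw [mem_range_bdry_orthogonal]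
    intro x
    simp only [Fin.sum_univ_succ]
    change (-1 : ℂ) ^ 0 * (f (x.1 2) - f (x.1 1)) + ((-1 : ℂ) ^ 1 * (f (x.1 2) - f (x.1 0)) +
      ((-1 : ℂ) ^ 2 * (f (x.1 1) - f (x.1 0)) + 0)) = 0
    ring
  convert h1
  ext x
  exact hf x

/-- The chain `u` on `X_F` is homologous in `X_{F'}` to the edge from `1` to `y`. -/
def IsPathChain (F : Finset G) (y : G) (u : EllTwo (Cell F 1)) (F' : Finset G) : Prop :=
  ∃ (h : F ⊆ F') (hy : 1⁻¹ * y ∈ F'), push (incl h 1) (bddFibers_incl h 1) u - dl (edge F' 1 y hy) ∈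
    LinearMap.range (bdry F' 1).toLinearMap

theorem IsPathChain.mono {F F' F'' : Finset G} {y : G} {u : EllTwo (Cell F 1)}
    (hu : IsPathChain F y u F') (h' : F' ⊆ F'') : IsPathChain F y u F'' := by
  obtain ⟨h, hy, ζ, hζ⟩ := hu
  refine ⟨h.trans h', h' hy, push (incl h' 2) (bddFibers_incl h' 2) ζ, ?_⟩
  change bdry F'' 1 _ = _
  rw [← push_incl_bdry, show bdry F' 1 ζ = _ from hζ, map_sub, push_incl_push_incl, push_dl]
  rfl

theorem bdry_tri_mem {F : Finset G} {x y : G} (hx : 1⁻¹ * x ∈ F) (hy : 1⁻¹ * y ∈ F)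
    (hxy : x⁻¹ * y ∈ F) : dl (edge F x y hxy) - dl (edge F 1 y hy) + dl (edge F 1 x hx) ∈
      LinearMap.range (bdry F 1).toLinearMap :=
  ⟨_, bdry_one_tri 1 x y hx hy hxy⟩

/-- If `F` generates `G`, then each vertex is joined to `1` by a path in `X_F`, and this path is
homologous to the straight edge once `F'` is large enough. -/
theorem exists_isPathChain {F : Finset G} (hF : Subgroup.closure (F : Set G) = ⊤) (y : G) :
    ∃ u F', IsPathChain F y u F' := by
  classical
  have hy : y ∈ Subgroup.closure (F : Set G) := by rw [hF]; trivial
  induction hy using Subgroup.closure_induction_right with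
  | one =>
    have h1 : (1 : G)⁻¹ * 1 ∈ insert 1 F := by simp
    refine ⟨0, insert 1 F, Finset.subset_insert _ _, h1, ?_⟩
    rw [map_zero, zero_sub]
    refine neg_mem ?_
    simpa using bdry_tri_mem h1 h1 h1
  | mul_right y _ s hs ih =>
    obtain ⟨u, F', hu⟩ := ih
    obtain ⟨h, hy, hu⟩ := hu.mono (Finset.subset_insert (y * s) F')
    have hys : (1 : G)⁻¹ * (y * s) ∈ insert (y * s) F' := by simp
    have hs' : y⁻¹ * (y * s) ∈ F := by simpa using hs
    refine ⟨u + dl (edge F y (y * s) hs'), insert (y * s) F', h, hys, ?_⟩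
    have := add_mem hu (bdry_tri_mem hy hys (h hs'))
    convert this using 1
    rw [map_add, push_dl]
    change _ + dl (edge _ y (y * s) (h hs')) - _ = _
    abel
  | mul_inv_cancel y _ s hs ih =>
    obtain ⟨u, F', hu⟩ := ih
    obtain ⟨h, hy, hu⟩ := hu.mono (Finset.subset_insert (y * s⁻¹) F')
    have hys : (1 : G)⁻¹ * (y * s⁻¹) ∈ insert (y * s⁻¹) F' := by simp
    have hs' : (y * s⁻¹)⁻¹ * y ∈ F := by simpa using hs
    refine ⟨u - dl (edge F (y * s⁻¹) y hs'), insert (y * s⁻¹) F', h, hys, ?_⟩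
    have := sub_mem hu (bdry_tri_mem hys hy (h hs'))
    convert this using 1
    rw [map_sub, push_dl]
    change _ - dl (edge _ (y * s⁻¹) y (h hs')) - _ = _
    abel

theorem exactCells_eq {F : Finset G} (hF : Subgroup.closure (F : Set G) = ⊤) :
    exactCells F = (⨆ F' : Set.Ici F, boundaries (Set.mem_Ici.1 F'.2) 1)ᗮ := by
  classical
  refine le_antisymm ?_ fun c hc => ?_
  · rw [← Submodule.iInf_orthogonal]
    exact le_iInf fun F' => exactCells_le_boundaries_orthogonal _ hF
  · choose u F' hu using exists_isPathChain hF
    refine ⟨fun y => inner ℂ (u y) c, fun x => ?_⟩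
    obtain ⟨h, h0, hu0⟩ := (hu (x.1 0)).mono (Finset.subset_union_left (s₂ := F' (x.1 1)))
    obtain ⟨_, h1, hu1⟩ := (hu (x.1 1)).mono (Finset.subset_union_right (s₁ := F' (x.1 0)))
    have hx : (x.1 0)⁻¹ * x.1 1 ∈ F := x.2 0 1 (by simp)
    -- The loop through `1` and the edge `x` bounds once `F'` is large enough.
    have hmem : u (x.1 0) + dl x - u (x.1 1) ∈ boundaries h 1 := by
      refine Submodule.le_topologicalClosure _ ?_
      have := add_mem (sub_mem hu0 hu1) (bdry_tri_mem h0 h1 (h hx))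
      convert this using 1
      change push _ _ _ = _
      rw [map_sub, map_add, push_dl, show incl h 1 x = edge _ _ _ (h hx) from eq_edge _ rfl rfl]
      abel
    have := hc _ (Submodule.mem_iSup_of_mem (⟨_, h⟩ : Set.Ici F) hmem)
    rw [inner_sub_left, inner_add_left, inner_dl] at this
    linear_combination this

/-- The infimum over `F'` in the Cheeger-Gromov formula for `β₁`, for generating `F`. -/
theorem iInf_vnDim_eq {F : Finset G} (hF : Subgroup.closure (F : Set G) = ⊤) :
    0 ≤ realDim (cellVec F 1) (exactCells F) - 1 + realDim (cellVec F 0) (constCochains F) ∧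
    (⨅ F' : Finset G, ⨅ h : F ⊆ F', vnDim (cellVec F 1) (cycles F 1 ⊓ (boundaries h 1)ᗮ)) =
      ENNReal.ofReal (realDim (cellVec F 1) (exactCells F) - 1 +
        realDim (cellVec F 0) (constCochains F)) := by
  classical
  have hval : ∀ {F' : Finset G} (h : F ⊆ F'),
      realDim (cellVec F 1) (cycles F 1 ⊓ (boundaries h 1)ᗮ) =
        realDim (cellVec F 1) (cycles F 1) - realDim (cellVec F 1) (boundaries h 1) := fun h =>
    realDim_inf_orthogonal _ (isClosed_cycles F) (isClosed_boundaries h 1) (boundaries_le_cycles h)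
  have hlim := tendsto_realDim_iSup (cellVec F 1)
    (B := fun F' : Set.Ici F => boundaries (Set.mem_Ici.1 F'.2) 1)
    (fun a b hab => boundaries_mono (Set.mem_Ici.1 a.2) hab 1) fun a => isClosed_boundaries _ 1
  have hexact : realDim (cellVec F 1) (cycles F 1) -
      realDim (cellVec F 1) (⨆ F' : Set.Ici F, boundaries (Set.mem_Ici.1 F'.2) 1) =
        realDim (cellVec F 1) (exactCells F) - 1 + realDim (cellVec F 0) (constCochains F) := by
    rw [exactCells_eq hF, realDim_orthogonal (cellVec F 1) fun i => norm_dl _, realDim_cycles hF]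
    ring
  have hlim' := hlim.const_sub (realDim (cellVec F 1) (cycles F 1))
  rw [hexact] at hlim'
  refine ⟨ge_of_tendsto' hlim' fun a => ?_, le_antisymm ?_ ?_⟩
  · rw [← hval]
    exact realDim_nonneg _ _
  · refine ge_of_tendsto' ((ENNReal.continuous_ofReal.tendsto _).comp hlim') fun a => ?_
    refine (iInf₂_le a.1 a.2).trans_eq ?_
    rw [vnDim_eq_ofReal, hval (Set.mem_Ici.1 a.2), Function.comp_apply]
  · refine le_iInf fun F' => le_iInf fun h => ?_
    rw [vnDim_eq_ofReal, hval, ← hexact]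
    refine ENNReal.ofReal_le_ofReal (sub_le_sub_left (realDim_mono _ ?_) _)
    exact le_iSup (fun F' : Set.Ici F => boundaries (Set.mem_Ici.1 F'.2) 1) ⟨F', h⟩

/-- The inclusion of `X_F` into `X_{F₂}` induces an injective map between the spaces of cycles
modulo the boundaries of `X_{F'}`. -/
theorem vnDim_cycles_inf_le {F F₂ F' : Finset G} (h : F ⊆ F₂) (h' : F₂ ⊆ F') :
    vnDim (cellVec F 1) (cycles F 1 ⊓ (boundaries (h.trans h') 1)ᗮ) ≤
      vnDim (cellVec F₂ 1) (cycles F₂ 1 ⊓ (boundaries h' 1)ᗮ) := by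
  rw [vnDim_eq_ofReal, vnDim_eq_ofReal]
  refine ENNReal.ofReal_le_ofReal ?_
  have hB := (invariant_boundaries h' 1).orthogonal
  refine realDim_le_of_injOn (isFreeBasis_cell F 1) (isFreeBasis_cell F₂ 1)
    ((invariant_cycles F).inf (invariant_boundaries _ 1).orthogonal) ((invariant_cycles F₂).inf hB)
    ((isClosed_cycles F).inter (Submodule.isClosed_orthogonal _))
    (hB.equivariant_closProj.comp (equivariant_push_incl h 1)) ?_ ?_
  · rintro ξ ⟨hξ, -⟩
    refine ⟨?_, closProj_mem_of_isClosed (Submodule.isClosed_orthogonal _) _⟩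
    rw [ContinuousLinearMap.comp_apply, closProj_orthogonal]
    refine sub_mem ?_ (boundaries_le_cycles h'
      (closProj_mem_of_isClosed (isClosed_boundaries _ _) _))
    change bdry F₂ 0 _ = 0
    rw [← push_incl_bdry, show bdry F 0 ξ = 0 from hξ, map_zero]
  · rintro ξ ⟨-, hξ⟩ h0
    rw [ContinuousLinearMap.comp_apply, closProj_orthogonal, sub_eq_zero] at h0
    have h1 : push (incl h 1) (bddFibers_incl h 1) ξ ∈ boundaries h' 1 := by
      rw [h0]
      exact closProj_mem_of_isClosed (isClosed_boundaries _ _) _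
    have h2 : ξ ∈ boundaries (h.trans h') 1 := by
      change push _ _ _ ∈ (LinearMap.range (bdry F' 1).toLinearMap).topologicalClosure
      rw [← push_incl_push_incl h h']
      exact h1
    exact inner_self_eq_zero.1 (hξ ξ h2)

/-- The edges of the Cayley graph of `G` for a family of elements indexed by `ι`: one edge for each
label and each initial vertex. -/
@[ext] structure CayleyEdge (ι G : Type*) where
  /-- The index of the group element by which the edge multiplies. -/
  label : ι
  /-- The initial vertex. -/
  src : G

instance (ι : Type*) : MulAction G (CayleyEdge ι G) where
  smul h e := ⟨e.label, h * e.src⟩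
  one_smul _ := CayleyEdge.ext rfl (one_mul _)
  mul_smul _ _ _ := CayleyEdge.ext rfl (mul_assoc _ _ _)

/-- The trace vectors of `ℓ²` of the edges of the Cayley graph. -/
noncomputable def cayleyVec (ι G : Type*) [Group G] (j : ι) : EllTwo (CayleyEdge ι G) :=
  dl ⟨j, 1⟩

/-- The exact `1`-cochains on the Cayley graph of `g`, where the edge with label `j` and initial
vertex `x` ends at `x * g j`. -/
abbrev exactCayley {ι : Type*} (g : ι → G) : Submodule ℂ (EllTwo (CayleyEdge ι G)) :=
  exactCochains CayleyEdge.src (fun e => e.src * g e.label)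

theorem isFreeBasis_cayleyEdge (ι : Type*) :
    IsFreeBasis G (fun j : ι => (⟨j, 1⟩ : CayleyEdge ι G)) := by
  refine ⟨?_, fun e => ⟨(e.src, e.label), CayleyEdge.ext rfl (mul_one _)⟩⟩
  rintro ⟨h, j⟩ ⟨h', j'⟩ he
  have h1 : h * 1 = h' * 1 := congrArg CayleyEdge.src he
  exact Prod.ext (by simpa using h1) (congrArg CayleyEdge.label he)

theorem containsCayley_cayleyEdge {ι : Type*} {g : ι → G}
    (hgen : Subgroup.closure (Set.range g) = ⊤) :
    ContainsCayley CayleyEdge.src (fun e : CayleyEdge ι G => e.src * g e.label) := by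
  refine ⟨Set.range g, hgen, ?_⟩
  rintro x _ ⟨j, rfl⟩
  exact ⟨⟨j, x⟩, rfl, rfl⟩

theorem realDim_exactCells_le {ι : Type*} [Fintype ι] {g : ι → G}
    (hgen : Subgroup.closure (Set.range g) = ⊤) {F : Finset G} (hF : ∀ j, g j ∈ F) :
    realDim (cellVec F 1) (exactCells F) ≤ realDim (cayleyVec ι G) (exactCayley g) := by
  have hF' : Subgroup.closure (F : Set G) = ⊤ := by
    rw [eq_top_iff, ← hgen]
    exact Subgroup.closure_mono (Set.range_subset_iff.2 hF)
  let k : CayleyEdge ι G → Cell F 1 := fun e =>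
    edge F e.src (e.src * g e.label) (by simpa using hF e.label)
  have hk : BddFibers k := by
    refine ⟨Fintype.card ι, fun b => ?_⟩
    have : Set.InjOn CayleyEdge.label (k ⁻¹' {b}) := by
      intro e he e' he' h
      exact CayleyEdge.ext h (congrArg (fun z : Cell F 1 => z.1 0)
        ((show k e = b from he).trans (show k e' = b from he').symm))
    rw [← this.encard_image, ← ENat.card_eq_coe_fintype_card, ← Set.encard_univ]
    exact Set.encard_le_encard (Set.subset_univ _)
  exact realDim_exactCochains_le (isFreeBasis_cell F 1) (isFreeBasis_cayleyEdge ι)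
    (fun _ _ => rfl) (fun _ _ => rfl) (fun _ _ => rfl) (fun _ _ => mul_assoc _ _ _)
    (containsCayley_cell hF') (containsCayley_cayleyEdge hgen) k hk
    (fun h e => cell_ext fun i => by
      fin_cases i
      · rfl
      · exact mul_assoc _ _ _)
    (fun _ => rfl) (fun _ => rfl)

theorem le_realDim_exactCells {ι : Type*} [Fintype ι] {g : ι → G}
    (hgen : Subgroup.closure (Set.range g) = ⊤) {F : Finset G} (hF : (F : Set G) = Set.range g) :
    realDim (cayleyVec ι G) (exactCayley g) ≤ realDim (cellVec F 1) (exactCells F) := by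
  have hlabel : ∀ s : F, ∃ j, g j = s := fun s => by
    have : (s : G) ∈ (F : Set G) := s.2
    rwa [hF] at this
  choose σ hσ using hlabel
  let k : Cell F 1 → CayleyEdge ι G := fun x =>
    ⟨σ ⟨(x.1 0)⁻¹ * x.1 1, x.2 0 1 (by simp)⟩, x.1 0⟩
  have hktgt : ∀ x, (k x).src * g (k x).label = x.1 1 := fun x => by
    simp only [k, hσ, mul_inv_cancel_left]
  have hk : BddFibers k := bddFibers_of_injective fun x y hxy => by
    refine cell_ext fun i => ?_
    fin_cases i
    · exact congrArg CayleyEdge.src hxy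
    · change x.1 1 = y.1 1
      rw [← hktgt, hxy, hktgt]
  refine realDim_exactCochains_le (isFreeBasis_cayleyEdge ι) (isFreeBasis_cell F 1)
    (fun _ _ => rfl) (fun _ _ => mul_assoc _ _ _) (fun _ _ => rfl) (fun _ _ => rfl)
    (containsCayley_cayleyEdge hgen) (containsCayley_cell (by rw [hF, hgen])) k hk
    (fun h x => CayleyEdge.ext (congrArg σ (Subtype.ext ?_)) rfl) (fun _ => rfl) hktgt
  change (h * x.1 0)⁻¹ * (h * x.1 1) = (x.1 0)⁻¹ * x.1 1
  group

/-- `β₁(G)` in terms of the exact square-summable `1`-cochains on the Cayley graph. -/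
theorem l2Betti_one {ι : Type*} [Fintype ι] {g : ι → G}
    (hgen : Subgroup.closure (Set.range g) = ⊤) (F₀ : Finset G) :
    0 ≤ realDim (cayleyVec ι G) (exactCayley g) - 1 +
      realDim (cellVec F₀ 0) (constCochains F₀) ∧
    l2Betti G 1 = ENNReal.ofReal (realDim (cayleyVec ι G) (exactCayley g) - 1 +
      realDim (cellVec F₀ 0) (constCochains F₀)) := by
  classical
  -- The space of constants does not depend on the subcomplex.
  have hconst : ∀ F, realDim (cellVec F 0) (constCochains F) =
      realDim (cellVec F₀ 0) (constCochains F₀) := fun F =>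
    (realDim_constCochains_le F F₀).antisymm (realDim_constCochains_le F₀ F)
  let S : Finset G := Finset.univ.image g
  have hSr : (S : Set G) = Set.range g := by simp [S]
  have hS : Subgroup.closure (S : Set G) = ⊤ := by rw [hSr, hgen]
  have hgS : ∀ F j, g j ∈ F ∪ S := fun F j => by simp [S]
  have hdim : realDim (cellVec S 1) (exactCells S) = realDim (cayleyVec ι G) (exactCayley g) :=
    (realDim_exactCells_le hgen fun j => by simp [S]).antisymm (le_realDim_exactCells hgen hSr)
  have hSval := iInf_vnDim_eq hS
  rw [hdim, hconst] at hSval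
  refine ⟨hSval.1, le_antisymm (iSup_le fun F => ?_) ?_⟩
  · have hFS : Subgroup.closure ((F ∪ S : Finset G) : Set G) = ⊤ := by
      rw [eq_top_iff, ← hS]
      exact Subgroup.closure_mono (by simp)
    have h1 := (iInf_vnDim_eq hFS).2
    rw [hconst] at h1
    refine le_trans ?_ (h1.le.trans (ENNReal.ofReal_le_ofReal ?_))
    · exact le_iInf fun F' => le_iInf fun h =>
        (iInf₂_le F' (Finset.subset_union_left.trans h)).trans
          (vnDim_cycles_inf_le Finset.subset_union_left h)
    · have := realDim_exactCells_le hgen (hgS F)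
      linarith
  · rw [← hSval.2]
    exact le_iSup (fun F : Finset G => ⨅ F' : Finset G, ⨅ h : F ⊆ F',
      vnDim (cellVec F 1) (cycles F 1 ⊓ (boundaries h 1)ᗮ)) S

end DegreeOne

/-! ### Approximation by cochains with bounded primitives -/

section Bounded

/-- Truncation of a real number at `±N`. -/
def clip (N t : ℝ) : ℝ := max (-N) (min t N)

theorem clip_sub_clip {N s t : ℝ} (h : s ≤ t) :
    0 ≤ clip N t - clip N s ∧ clip N t - clip N s ≤ t - s := by
  unfold clip
  constructor
  · exact sub_nonneg.2 (max_le_max le_rfl (min_le_min h le_rfl))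
  · rcases max_cases (-N) (min t N) with h1 | h1 <;>
      rcases max_cases (-N) (min s N) with h2 | h2 <;>
      rcases min_cases t N with h3 | h3 <;> rcases min_cases s N with h4 | h4 <;> linarith

theorem abs_clip_le {N : ℝ} (hN : 0 ≤ N) (t : ℝ) : |clip N t| ≤ N :=
  abs_le.2 ⟨le_max_left _ _, max_le (by linarith) (min_le_right _ _)⟩

theorem clip_of_abs_le {N t : ℝ} (h : |t| ≤ N) : clip N t = t := by
  rw [clip, min_eq_left (abs_le.1 h).2, max_eq_right (abs_le.1 h).1]

theorem clip_sq_le (N s t : ℝ) : (clip N t - clip N s) ^ 2 ≤ (t - s) ^ 2 := by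
  rcases le_total s t with h | h
  · have := clip_sub_clip (N := N) h
    nlinarith
  · have := clip_sub_clip (N := N) h
    nlinarith

theorem clip_mul_nonneg (N s t : ℝ) : 0 ≤ (clip N t - clip N s) * (t - s) := by
  rcases le_total s t with h | h
  · exact mul_nonneg (clip_sub_clip h).1 (sub_nonneg.2 h)
  · exact mul_nonneg_of_nonpos_of_nonpos (by linarith [(clip_sub_clip (N := N) h).1])
      (sub_nonpos.2 h)

/-- Truncation of the real and of the imaginary part of a complex number at `±N`. -/
def cclip (N : ℝ) (z : ℂ) : ℂ := ⟨clip N z.re, clip N z.im⟩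

/-- The exact cochains with bounded primitives are dense in the exact cochains. The primitive `F` of
a cochain `c` is truncated: each term of the inner product of `c` with the coboundary of the
truncation is nonnegative, and for a given edge it is `|c e| ^ 2` for large `N`. -/
theorem eq_zero_of_orthogonal_bounded {V E : Type*} {src tgt : E → V} {c : EllTwo E}
    (hc : c ∈ exactCochains src tgt)
    (h : ∀ (f : V → ℂ) (d : EllTwo E), (∃ C, ∀ x, ‖f x‖ ≤ C) →
      (∀ e, d e = f (tgt e) - f (src e)) → inner ℂ d c = 0) : c = 0 := by
  obtain ⟨F, hF⟩ := hc
  have hterm : ∀ N : ℝ, 0 ≤ N → ∀ e,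
      (clip N (F (tgt e)).re - clip N (F (src e)).re) * ((F (tgt e)).re - (F (src e)).re) +
      (clip N (F (tgt e)).im - clip N (F (src e)).im) * ((F (tgt e)).im - (F (src e)).im) = 0 := by
    intro N hN
    have hmem : Memℓp (fun e => cclip N (F (tgt e)) - cclip N (F (src e))) 2 := by
      refine memEllTwo_of_sum_le _ (‖c‖ ^ 2) fun s => le_trans ?_ (ellTwo_sum_le c s)
      refine Finset.sum_le_sum fun e _ => ?_
      rw [hF, ← Complex.normSq_eq_norm_sq, ← Complex.normSq_eq_norm_sq, Complex.normSq_apply,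
        Complex.normSq_apply]
      have h1 := clip_sq_le N (F (src e)).re (F (tgt e)).re
      have h2 := clip_sq_le N (F (src e)).im (F (tgt e)).im
      simp only [cclip, Complex.sub_re, Complex.sub_im]
      nlinarith
    have h0 := h (fun x => cclip N (F x)) ⟨_, hmem⟩ ⟨N + N, fun x => ?_⟩ fun e => rfl
    · have hs := Complex.hasSum_re (lp.hasSum_inner (𝕜 := ℂ) (⟨_, hmem⟩ : EllTwo E) c)
      rw [h0] at hs
      have hs' : HasSum (fun e =>
          (clip N (F (tgt e)).re - clip N (F (src e)).re) * ((F (tgt e)).re - (F (src e)).re) +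
          (clip N (F (tgt e)).im - clip N (F (src e)).im) *
            ((F (tgt e)).im - (F (src e)).im)) 0 := by
        refine hs.congr_fun fun e => ?_
        change _ = (c e * starRingEnd ℂ (cclip N (F (tgt e)) - cclip N (F (src e)))).re
        rw [hF]
        simp only [cclip, Complex.mul_re, Complex.conj_re, Complex.conj_im, Complex.sub_re,
          Complex.sub_im]
        ring
      have := (hasSum_zero_iff_of_nonneg fun e =>
        add_nonneg (clip_mul_nonneg _ _ _) (clip_mul_nonneg _ _ _)).1 hs'
      exact fun e => congrFun this e
    · refine (Complex.norm_le_abs_re_add_abs_im _).trans (add_le_add ?_ ?_) <;>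
        exact abs_clip_le hN _
  ext e
  -- A truncation level at which the values of `F` at both ends of `e` are unchanged.
  have hN := hterm (|(F (tgt e)).re| + |(F (src e)).re| + |(F (tgt e)).im| + |(F (src e)).im|)
    (by positivity) e
  have h1 := abs_nonneg (F (tgt e)).re
  have h2 := abs_nonneg (F (src e)).re
  have h3 := abs_nonneg (F (tgt e)).im
  have h4 := abs_nonneg (F (src e)).im
  rw [clip_of_abs_le (by linarith), clip_of_abs_le (by linarith), clip_of_abs_le (by linarith),
    clip_of_abs_le (by linarith)] at hN
  have h5 := (add_eq_zero_iff_of_nonneg (mul_self_nonneg _) (mul_self_nonneg _)).1 hN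
  rw [hF]
  refine Complex.ext ?_ ?_
  · simpa using mul_self_eq_zero.1 h5.1
  · simpa using mul_self_eq_zero.1 h5.2

end Bounded

/-! ### The right regular representation and the group von Neumann algebra -/

section Regular

variable {G : Type*} [Group G]

/-- The right regular representation, `(ρ_g ξ)(x) = ξ(x g)`. -/
noncomputable def rightReg (g : G) : Op G :=
  pull (fun x => x * g) (bddFibers_of_injective (mul_left_injective g))

theorem rightReg_apply (g : G) (ξ : EllTwo G) (x : G) : rightReg g ξ x = ξ (x * g) := rfl

theorem leftReg_apply (g : G) (ξ : EllTwo G) (x : G) : leftReg g ξ x = ξ (g⁻¹ * x) := rfl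

theorem rightReg_dl (g y : G) : rightReg g (dl y) = dl (y * g⁻¹) := by
  classical
  ext x
  simp [rightReg_apply, dl_apply, eq_mul_inv_iff_mul_eq]

theorem leftReg_dl (g y : G) : leftReg g (dl y) = dl (g * y) := by
  classical
  ext x
  simp [leftReg_apply, dl_apply, inv_mul_eq_iff_eq_mul]

theorem conjJ_apply (ξ : EllTwo G) (x : G) : conjJ G ξ x = starRingEnd ℂ (ξ x⁻¹) := rfl

theorem JXJ_leftReg (g : G) : JXJ (leftReg g) = rightReg g := by
  ext ξ x
  change conjJ G (leftReg g (conjJ G ξ)) x = _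
  rw [conjJ_apply, leftReg_apply, conjJ_apply, Complex.conj_conj, rightReg_apply, mul_inv_rev,
    inv_inv, inv_inv]

theorem leftReg_mem_groupVN (g : G) : leftReg g ∈ groupVN G :=
  subset_closure ⟨_, Submodule.subset_span ⟨g, rfl⟩, rfl⟩

/-- The elements of the group von Neumann algebra commute with the right translations. -/
theorem groupVN_comm {m : Op G} (hm : m ∈ groupVN G) (g : G) :
    m * rightReg g = rightReg g * m := by
  have hspan : ∀ T ∈ Submodule.span ℂ (Set.range (leftReg (G := G))), ∀ ξ x,
      T (rightReg g ξ) x = T ξ (x * g) := by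
    intro T hT
    induction hT using Submodule.span_induction with
    | mem T hT =>
      obtain ⟨h, rfl⟩ := hT
      intro ξ x
      rw [leftReg_apply, leftReg_apply, rightReg_apply, mul_assoc]
    | zero => exact fun _ _ => rfl
    | add S T _ _ hS hT =>
      intro ξ x
      rw [add_apply, add_apply, lp.coeFn_add, lp.coeFn_add, Pi.add_apply, Pi.add_apply, hS, hT]
    | smul c T _ hT =>
      intro ξ x
      rw [smul_apply, smul_apply, lp.coeFn_smul, lp.coeFn_smul, Pi.smul_apply, Pi.smul_apply, hT]
  ext ξ x
  change m (rightReg g ξ) x = m ξ (x * g)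
  have hcont : ∀ (η : EllTwo G) (y : G),
      Continuous fun T : EllTwo G →WOT[ℂ] EllTwo G => (T η) y := by
    intro η y
    simp only [← inner_dl y]
    exact ContinuousLinearMapWOT.continuous_dual_apply η (innerSL ℂ (dl y))
  have hclosed : IsClosed {T : EllTwo G →WOT[ℂ] EllTwo G | T (rightReg g ξ) x = T ξ (x * g)} :=
    isClosed_eq (hcont _ _) (hcont _ _)
  refine closure_minimal ?_ hclosed hm
  rintro _ ⟨T, hT, rfl⟩
  exact hspan T hT ξ x

theorem commutator_dl (f : lp (fun _ : G => ℂ) ∞) (g y : G) :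
    (mulOp f * rightReg g - rightReg g * mulOp f) (dl y) =
      (f (y * g⁻¹) - f y) • dl (y * g⁻¹) := by
  classical
  ext x
  change f x * rightReg g (dl y) x - f (x * g) * dl y (x * g) = (f (y * g⁻¹) - f y) * dl _ x
  rw [rightReg_apply, dl_apply, dl_apply]
  by_cases h : x * g = y
  · subst h
    simp
  · rw [if_neg h, if_neg (by rwa [eq_mul_inv_iff_mul_eq])]
    simp

end Regular

/-! ### The closure of the bimodule of commutators -/

section Bimodule

variable {G : Type*} [Group G] {ι : Type*}

/-- The set of matrix entries `(j, x, y)` is partitioned into fibres according to the value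
`u = x * g j * y⁻¹`. This is the parametrization of the fibre over `u` by the edges of the Cayley
graph; the edge with label `j` and initial vertex `x` corresponds to the entry at
`(j, x, u⁻¹ * x * g j)`. -/
def fibre (g : ι → G) (u : G) (e : CayleyEdge ι G) : ι × G × G :=
  (e.label, e.src, u⁻¹ * (e.src * g e.label))

theorem fibre_injective (g : ι → G) (u : G) : Function.Injective (fibre g u) :=
  fun _ _ h => CayleyEdge.ext (congrArg Prod.fst h) (congrArg (fun p => p.2.1) h)

theorem bddFibers_fibre (g : ι → G) (u : G) : BddFibers (fibre g u) :=
  bddFibers_of_injective (fibre_injective g u)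

theorem fibre_notMem_range {g : ι → G} {u u' : G} (h : u ≠ u') (e : CayleyEdge ι G) :
    fibre g u e ∉ Set.range (fibre g u') := by
  rintro ⟨e', he⟩
  have h1 : e' = e := CayleyEdge.ext (congrArg Prod.fst he) (congrArg (fun p => p.2.1) he)
  subst h1
  have h2 : u'⁻¹ * _ = u⁻¹ * _ := congrArg (fun p => p.2.2) he
  exact h (inv_injective (mul_right_cancel h2)).symm

/-- The families of matrix coefficients whose restriction to each fibre is an exact cochain on the
Cayley graph. -/
noncomputable def fibrewiseExact (g : ι → G) : Submodule ℂ (EllTwo (ι × G × G)) :=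
  ⨅ u, (exactCayley g).comap (pull (fibre g u) (bddFibers_fibre g u)).toLinearMap

theorem mem_fibrewiseExact {g : ι → G} {ξ : EllTwo (ι × G × G)} :
    ξ ∈ fibrewiseExact g ↔ ∀ u, pull (fibre g u) (bddFibers_fibre g u) ξ ∈ exactCayley g := by
  simp [fibrewiseExact]

theorem isClosed_fibrewiseExact {g : ι → G} (hgen : Subgroup.closure (Set.range g) = ⊤) :
    IsClosed (fibrewiseExact g : Set (EllTwo (ι × G × G))) := by
  rw [fibrewiseExact, Submodule.coe_iInf]
  exact isClosed_iInter fun u => (containsCayley_cayleyEdge hgen).isClosed_exactCochains.preimage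
    (pull (fibre g u) (bddFibers_fibre g u)).continuous

theorem push_fibre_mem {g : ι → G} {c : EllTwo (CayleyEdge ι G)} (hc : c ∈ exactCayley g) (u : G) :
    push (fibre g u) (bddFibers_fibre g u) c ∈ fibrewiseExact g := by
  rw [mem_fibrewiseExact]
  intro u'
  by_cases h : u' = u
  · subst h
    rwa [pull_push (fibre_injective g u')]
  · convert zero_mem (exactCayley g)
    ext e
    rw [pull_apply, push_apply_of_notMem _ _ (fibre_notMem_range h e)]
    rfl

theorem closProj_fibrewiseExact {g : ι → G} (hgen : Subgroup.closure (Set.range g) = ⊤) (u : G)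
    (c : EllTwo (CayleyEdge ι G)) :
    closProj (fibrewiseExact g) (push (fibre g u) (bddFibers_fibre g u) c) =
      push (fibre g u) (bddFibers_fibre g u) (closProj (exactCayley g) c) := by
  have hZ := (containsCayley_cayleyEdge hgen).isClosed_exactCochains
  refine closProj_eq_of_mem (Submodule.le_topologicalClosure _
    (push_fibre_mem (closProj_mem_of_isClosed hZ c) u)) ?_
  rw [← map_sub]
  intro ξ hξ
  rw [inner_push_right]
  exact sub_closProj_mem (exactCayley g) c _ (mem_fibrewiseExact.1 hξ u)

theorem realDim_fibrewiseExact [Fintype ι] {g : ι → G}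
    (hgen : Subgroup.closure (Set.range g) = ⊤) :
    realDim (fun j : ι => (dl (j, 1, 1) : EllTwo (ι × G × G))) (fibrewiseExact g) =
      realDim (cayleyVec ι G) (exactCayley g) := by
  refine Finset.sum_congr rfl fun j _ => ?_
  have h1 : (dl (j, 1, 1) : EllTwo (ι × G × G)) =
      push (fibre g (g j)) (bddFibers_fibre g (g j)) (cayleyVec ι G j) := by
    rw [cayleyVec, push_dl, fibre]
    simp
  simp only [h1]
  rw [closProj_fibrewiseExact hgen, inner_push_left, pull_push (fibre_injective g (g j))]

theorem hsVec_apply {ι A : Type*} [Finite ι] (Ξ : ι → HS A) (p : ι × A × A) :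
    hsVec Ξ p = (Ξ p.1 : Op A) (dl p.2.2) p.2.1 := rfl

/-- On the fibre over `u`, a tuple of commutators with `D` is the coboundary of the function
`x ↦ - D x (u⁻¹ x)`. -/
theorem hsVec_Hzero_le [Finite ι] (g : ι → G) :
    (Hzero fun j => leftReg (g j)).map hsVec ≤ fibrewiseExact g := by
  rintro _ ⟨Ξ, ⟨D, hD⟩, rfl⟩
  rw [mem_fibrewiseExact]
  intro u
  refine ⟨fun x => -(D (dl (u⁻¹ * x)) x), fun e => ?_⟩
  rw [pull_apply, hsVec_apply, hD, JXJ_leftReg]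
  change D (rightReg (g e.label) (dl (u⁻¹ * (e.src * g e.label)))) e.src -
    D (dl (u⁻¹ * (e.src * g e.label))) (e.src * g e.label) = _
  rw [rightReg_dl, show u⁻¹ * (e.src * g e.label) * (g e.label)⁻¹ = u⁻¹ * e.src by group]
  ring

theorem multBimod_le_Hzero (g : ι → G) : multBimod g ≤ Hzero fun j => leftReg (g j) := by
  refine Submodule.span_le.2 ?_
  rintro Ξ ⟨m, hm, m', hm', a, ⟨f, -, ha⟩, hΞ⟩
  refine ⟨m * mulOp f * m', fun j => ?_⟩
  have h1 := groupVN_comm hm (g j)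
  have h2 := groupVN_comm hm' (g j)
  rw [hΞ, ha, JXJ_leftReg, mul_sub, sub_mul]
  congr 1
  · rw [mul_assoc m, mul_assoc (mulOp f), ← h2]
    simp only [mul_assoc]
  · rw [← mul_assoc, h1]
    simp only [mul_assoc]

theorem commutator_mem_HS (f : lp (fun _ : G => ℂ) ∞) {g : G}
    (hf : Memℓp (fun h : G => f (h * g) - f h) 2) :
    mulOp f * rightReg g - rightReg g * mulOp f ∈ HS G := by
  change Summable fun y => ‖(mulOp f * rightReg g - rightReg g * mulOp f) (dl y)‖ ^ 2
  have h1 := (memEllTwo_comp hf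
    (bddFibers_of_injective (mul_left_injective g⁻¹))).summable (by norm_num)
  refine h1.congr fun y => ?_
  rw [commutator_dl, norm_smul, norm_dl, mul_one, ← norm_neg]
  simp

theorem mul_leftReg_mem_HS {T : Op G} (hT : T ∈ HS G) (u : G) : T * leftReg u ∈ HS G := by
  change Summable fun y => ‖T (leftReg u (dl y))‖ ^ 2
  simp only [leftReg_dl]
  exact (show Summable fun y => ‖T (dl y)‖ ^ 2 from hT).comp_injective (mul_right_injective u)

/-- For a bounded function `f` with square-summable coboundary, the tuple `([m_f, ρ_j] λ_u)_j` of
`M A M` is supported on the fibre over `u`, where it is minus the coboundary of `f`. -/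
theorem push_fibre_mem_multBimod [Finite ι] (g : ι → G) (u : G) {f : G → ℂ}
    (hf : ∃ C, ∀ x, ‖f x‖ ≤ C) {d : EllTwo (CayleyEdge ι G)}
    (hd : ∀ e, d e = f (e.src * g e.label) - f e.src) :
    push (fibre g u) (bddFibers_fibre g u) d ∈ (multBimod g).map hsVec := by
  classical
  obtain ⟨C, hC⟩ := hf
  let f' : lp (fun _ : G => ℂ) ∞ := ⟨f, memℓp_infty ⟨C, by rintro _ ⟨x, rfl⟩; exact hC x⟩⟩
  have hδ : ∀ j, Memℓp (fun h : G => f' (h * g j) - f' h) 2 := by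
    intro j
    have hb : BddFibers fun x : G => (⟨j, x⟩ : CayleyEdge ι G) :=
      bddFibers_of_injective fun x y h => congrArg CayleyEdge.src h
    convert memEllTwo_comp (lp.memℓp d) hb using 2 with x
    exact (hd ⟨j, x⟩).symm
  let a : ι → HS G := fun j => ⟨_, commutator_mem_HS f' (hδ j)⟩
  let b : ι → HS G := fun j => ⟨_, mul_leftReg_mem_HS (a j).2 u⟩
  have hone : (1 : Op G) ∈ groupVN G := by
    have := leftReg_mem_groupVN (1 : G)
    rwa [show leftReg (1 : G) = 1 from clm_ext_dl fun x => by simp [leftReg_dl]] at this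
  have hb : b ∈ multBimod g := Submodule.subset_span
    ⟨1, hone, leftReg u, leftReg_mem_groupVN u, a,
      ⟨f', hδ, fun j => by rw [JXJ_leftReg]⟩, fun j => by rw [one_mul]⟩
  refine ⟨-b, neg_mem hb, ?_⟩
  ext p
  obtain ⟨j, x, y⟩ := p
  have hval : hsVec (-b) (j, x, y) =
      -((f (u * y * (g j)⁻¹) - f (u * y)) * dl (u * y * (g j)⁻¹) x) := by
    change -((mulOp f' * rightReg (g j) - rightReg (g j) * mulOp f') (leftReg u (dl y)) x) = _
    rw [leftReg_dl, commutator_dl]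
    rfl
  rw [hval]
  by_cases h : y = u⁻¹ * (x * g j)
  · subst h
    have h1 := push_apply (fibre_injective g u) (bddFibers_fibre g u) d ⟨j, x⟩
    rw [fibre] at h1
    rw [h1, hd, mul_inv_cancel_left, mul_inv_cancel_right, dl_apply, if_pos rfl]
    ring
  · rw [push_apply_of_notMem, dl_apply, if_neg]
    · simp
    · intro hx
      apply h
      rw [hx]
      group
    · rintro ⟨e, he⟩
      have h1 : e.label = j := congrArg Prod.fst he
      have h2 : e.src = x := congrArg (fun p => p.2.1) he
      have h3 : u⁻¹ * (e.src * g e.label) = y := congrArg (fun p => p.2.2) he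
      rw [h1, h2] at h3
      exact h h3.symm

/-- The Hilbert-Schmidt closure of `M A M` consists of the tuples that are exact on each fibre. -/
theorem topologicalClosure_multBimod [Finite ι] {g : ι → G}
    (hgen : Subgroup.closure (Set.range g) = ⊤) :
    ((multBimod g).map hsVec).topologicalClosure = fibrewiseExact g := by
  have hle : ((multBimod g).map hsVec).topologicalClosure ≤ fibrewiseExact g :=
    Submodule.topologicalClosure_minimal _
      ((Submodule.map_mono (multBimod_le_Hzero g)).trans (hsVec_Hzero_le g))
      (isClosed_fibrewiseExact hgen)
  refine le_antisymm hle fun ξ hξ => ?_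
  have hP := closProj_mem ((multBimod g).map hsVec) ξ
  have hη := sub_mem hξ (hle hP)
  have hη' := sub_closProj_mem ((multBimod g).map hsVec) ξ
  generalize hdef : ξ - closProj ((multBimod g).map hsVec) ξ = η at hη hη'
  have h0 : ∀ u, pull (fibre g u) (bddFibers_fibre g u) η = 0 := by
    intro u
    refine eq_zero_of_orthogonal_bounded (mem_fibrewiseExact.1 hη u) fun f d hf hd => ?_
    rw [← inner_push_left]
    exact hη' _ (push_fibre_mem_multBimod g u hf hd)
  have hη0 : η = 0 := by
    ext p
    obtain ⟨j, x, y⟩ := p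
    have := congrArg (fun c : EllTwo (CayleyEdge ι G) => c ⟨j, x⟩) (h0 (x * g j * y⁻¹))
    have hp : fibre g (x * g j * y⁻¹) ⟨j, x⟩ = (j, x, y) := by
      simp [fibre, mul_assoc]
    rw [pull_apply, hp] at this
    exact this
  rw [hη0, sub_eq_zero] at hdef
  rwa [hdef]

theorem bimodDim_multBimod {ι : Type*} [Fintype ι] {g : ι → G}
    (hgen : Subgroup.closure (Set.range g) = ⊤) :
    bimodDim (multBimod g) = ENNReal.ofReal (realDim (cayleyVec ι G) (exactCayley g)) := by
  rw [bimodDim, vnDim_eq_ofReal, ← realDim_topologicalClosure, topologicalClosure_multBimod hgen,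
    realDim_fibrewiseExact hgen]

end Bimodule

end GroupL2

theorem mainTheorem4 {G : Type*} [Group G] (n : ℕ) (g : Fin n → G)
    (hsymm : ∀ i, ∃ j, g j = (g i)⁻¹) (hgen : Subgroup.closure (Set.range g) = ⊤) :
    ((GroupL2.l2Betti G 1 : EReal) - (GroupL2.l2Betti G 0 : EReal) + 1 ≤
      (GroupL2.deltaBar (fun j => GroupL2.leftReg (g j)) : EReal)) ∧
    GroupL2.multBimod g ≤ GroupL2.Hzero (fun j => GroupL2.leftReg (g j)) ∧
    (GroupL2.bimodDim (GroupL2.multBimod g) : EReal) =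
      (GroupL2.l2Betti G 1 : EReal) - (GroupL2.l2Betti G 0 : EReal) + 1 := by
  have hdim : (GroupL2.bimodDim (GroupL2.multBimod g) : EReal) =
      (GroupL2.l2Betti G 1 : EReal) - (GroupL2.l2Betti G 0 : EReal) + 1 := by
    obtain ⟨hnonneg, h1⟩ := GroupL2.l2Betti_one hgen (∅ : Finset G)
    have h0 := GroupL2.l2Betti_zero (S := (Set.finite_range g).toFinset) (by simpa using hgen) ∅
    rw [GroupL2.bimodDim_multBimod hgen, h1, h0, EReal.coe_ennreal_ofReal,
      EReal.coe_ennreal_ofReal, EReal.coe_ennreal_ofReal,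
      max_eq_left (GroupL2.realDim_nonneg _ _), max_eq_left hnonneg,
      max_eq_left (GroupL2.realDim_nonneg _ _)]
    norm_cast
    ring
  refine ⟨?_, GroupL2.multBimod_le_Hzero g, hdim⟩
  rw [← hdim]
  exact EReal.coe_ennreal_le_coe_ennreal_iff.2
    (GroupL2.vnDim_mono _ (Submodule.map_mono (GroupL2.multBimod_le_Hzero g)))
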